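/- Setting. Let $\phi$ be a non-constant infinitely divisible probability law on $\mathbb{R}$ with $\int e^{sx}\,\phi(dx)<\infty$ for every $s\in\mathbb{R}$, and let $\eta$ be the entire function with $\eta(0)=0$ and $\int_{\mathbb{R}} e^{zx}\,\phi(dx)=e^{\eta(z)}$ for all $z\in\mathbb{C}$. Let $(X_n)$ be real random variables with $\mathbb{E}[e^{sX_n}]<\infty$ for all $s\in\mathbb{R}$, let $t_n\to+\infty$, and let $\psi$ be an entire function without zeros on $\mathbb{R}$ such that $$e^{-t_n\eta(z)}\,\mathbb{E}[e^{zX_n}]\longrightarrow\psi(z)\qquad\text{locally uniformly in } z\in\mathbb{C}$$ (mod-$\phi$ convergence with $c=+\infty$). Let $F(x)=\sup_{s\in\mathbb{R}}(sx-\eta(s))\in(-\infty,+\infty]$, and assume that $F$ is essentially smooth: $I_F=\{F<\infty\}$ is a non-empty closed interval, and $F'(x)\to+\infty$ (resp. $-\infty$) when $x$ goes to the upper (resp. lower) bound of $I_F$, this bound being finite or not. For a Borel set $B\subset\mathbb{R}$ with closure $\overline B$, call $B$ admissible if $F(b)<\infty$ for some $b\in\overline B$, and put $$F(B)=\inf_{u\in\overline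 B}F(u),\qquad B_{\min}=\{a\in\overline B : F(a)=F(B)\}.$$ For $a$ in the range of $\eta'$ on $\mathbb{R}$, $h(a)\in\mathbb{R}$ is defined by $\eta'(h(a))=a$. Theorem. Let $B$ be a Borel subset of $\mathbb{R}$. 1. If $B$ is admissible, then $B_{\min}$ has one or two elements. If moreover every $a\in B_{\min}$ lies in the range of $\eta'|_{\mathbb{R}}$, so that $h(a)$ is defined, then $$\limsup_{n\to\infty}\Big(\sqrt{2\pi t_n}\;e^{t_nF(B)}\;\mathbb{P}[X_n\in t_nB]\Big)\le\begin{cases}\displaystyle\sum_{a\in B_{\min}}\frac{\psi(h(a))}{(1-e^{-|h(a)|})\sqrt{\eta''(h(a))}}&\text{if }\phi\text{ is lattice},\\[3mm]\displaystyle\sum_{a\in B_{\min}}\frac{\psi(h(a))}{|h(a)|\sqrt{\eta''(h(a))}}&\text{if }\phi\text{ is non-lattice},\end{cases}$$ where the right-hand side is $+\infty$ if $\eta'(0)\in B_{\min}$. Here lattice means that $\phi$ is carried by $\gamma+\mathbb{Z}$ for some $\gamma\in\mathbb{R}$, and by no $\gamma'+\lambda\mathbb{Z}$ with $\lambda>1$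 (that is, the lattice is normalised to have minimal span $1$); non-lattice means that $\phi$ is carried by no set $\gamma+\lambda\mathbb{Z}$ with $\lambda>0$. 2. If $B$ is not admissible, then for every real $M>0$, $\displaystyle\lim_{n\to\infty}e^{t_nM}\,\mathbb{P}[X_n\in t_nB]=0$. -/

import Mathlib

open MeasureTheory ProbabilityTheory Filter Topology
open scoped ENNReal Pointwise

noncomputable section

namespace ModPhi

/-- `φ` is infinitely divisible: for every `n ≥ 1` it is the law of a sum of `n` independent
random variables with a common law `ν`. -/
def InfinitelyDivisible (φ : Measure ℝ) : Prop :=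
  ∀ n : ℕ, 1 ≤ n → ∃ ν : Measure ℝ, IsProbabilityMeasure ν ∧
    (Measure.pi (fun _ : Fin n => ν)).map (fun x : Fin n → ℝ => ∑ i, x i) = φ

/-- `φ` is carried by a shifted lattice `γ + lℤ`. -/
def CarriedByLattice (φ : Measure ℝ) (l : ℝ) : Prop :=
  ∃ γ : ℝ, φ (Set.range (fun k : ℤ => γ + l * (k : ℝ)))ᶜ = 0

/-- `φ` is of type lattice. -/
def IsLattice (φ : Measure ℝ) : Prop :=
  ∃ l : ℝ, 0 < l ∧ CarriedByLattice φ l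

/-- `φ` is of type lattice with minimal lattice `γ + lℤ` for some `γ`, i.e. `l > 0` is as big as
possible; the modulus of the characteristic function then has smallest period `2π / l`. -/
def HasLatticeSpan (φ : Measure ℝ) (l : ℝ) : Prop :=
  IsGreatest {l' : ℝ | 0 < l' ∧ CarriedByLattice φ l'} l

/-- Mod-`φ` convergence of the sequence `X` with parameters `t` and limiting function `ψ`, on the
whole complex plane (strip of half-width `c = +∞`).  The function `η` is the Lévy exponent of `φ`,
i.e. the analytic logarithm of its moment generating function normalised by `η 0 = 0`; these three
conditions determine it. -/
structure ModConverges {Ω : ℕ → Type*} [∀ n, MeasurableSpace (Ω n)]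
    (P : ∀ n, Measure (Ω n)) (X : ∀ n, Ω n → ℝ) (t : ℕ → ℝ)
    (φ : Measure ℝ) (η ψ : ℂ → ℂ) : Prop where
  infinitelyDivisible : InfinitelyDivisible φ
  nonconstant : ∀ a : ℝ, φ ≠ Measure.dirac a
  integrable_exp_law : ∀ s : ℝ, Integrable (fun x : ℝ => Real.exp (s * x)) φ
  integrable_exp : ∀ (n : ℕ) (s : ℝ), Integrable (fun ω => Real.exp (s * X n ω)) (P n)
  analytic_exponent : Differentiable ℂ η
  exponent_zero : η 0 = 0
  exp_exponent : ∀ z : ℂ, Complex.exp (η z) = complexMGF id φ z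
  analytic_limit : Differentiable ℂ ψ
  limit_ne_zero : ∀ x : ℝ, ψ x ≠ 0
  tendsto_parameters : Tendsto t atTop atTop
  tendsto_residue : TendstoLocallyUniformly
    (fun n z => Complex.exp (-(t n : ℂ) * η z) * complexMGF (X n) (P n) z) ψ atTop

/-- The exponent on the real line, `η(s) = log ∫ exp (s x) φ(dx)`. -/
def realExponent (φ : Measure ℝ) : ℝ → ℝ := cgf id φ

/-- The Legendre-Fenchel transform `F(x) = sup_{s ∈ ℝ} (s x - η(s))`, with values in `(-∞, +∞]`. -/
def legendre (φ : Measure ℝ) (x : ℝ) : EReal :=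
  ⨆ s : ℝ, ((s * x - realExponent φ s : ℝ) : EReal)

/-- The set `I_F` on which `F` is finite. -/
def finiteDomain (F : ℝ → EReal) : Set ℝ := {x | F x < ⊤}

/-- Essential smoothness: `F` is finite on a nonempty closed interval, and `F' → ±∞` at its upper
and lower bounds.  (The order filters `atTop` and `atBot` on the interior of the interval express
that `x` goes to its upper, resp. lower, bound, whether this bound is finite or not.) -/
structure EssentiallySmooth (F : ℝ → EReal) : Prop where
  nonempty : (finiteDomain F).Nonempty
  closed : IsClosed (finiteDomain F)
  interval : (finiteDomain F).OrdConnected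
  tendsto_upper : Tendsto
    (fun x : interior (finiteDomain F) => deriv (fun y => (F y).toReal) (x : ℝ)) atTop atTop
  tendsto_lower : Tendsto
    (fun x : interior (finiteDomain F) => deriv (fun y => (F y).toReal) (x : ℝ)) atBot atBot

/-- `B` is admissible: `F` is finite at some point of the closure of `B`. -/
def Admissible (F : ℝ → EReal) (B : Set ℝ) : Prop := ∃ b ∈ closure B, F b < ⊤

/-- `F(B)`, the minimum of `F` over the closure of `B`. -/
def rate (F : ℝ → EReal) (B : Set ℝ) : EReal := ⨅ u ∈ closure B, F u

/-- `B_min`, the set of points of the closure of `B` at which `F` takes the value `F(B)`. -/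
def minimizers (F : ℝ → EReal) (B : Set ℝ) : Set ℝ := {a ∈ closure B | F a = rate F B}

/-- The renormalised probability `√(2π tₙ) exp(tₙ F(B)) ℙ[Xₙ ∈ tₙ B]`. -/
def scaledProb {Ω : ℕ → Type*} [∀ n, MeasurableSpace (Ω n)]
    (P : ∀ n, Measure (Ω n)) (X : ∀ n, Ω n → ℝ) (t : ℕ → ℝ) (φ : Measure ℝ) (B : Set ℝ)
    (n : ℕ) : ℝ≥0∞ :=
  ENNReal.ofReal
      (Real.sqrt (2 * Real.pi * t n) * Real.exp (t n * (rate (legendre φ) B).toReal)) *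
    P n {ω | X n ω ∈ t n • B}

/-- The term `ψ(s) / (w √(η''(s)))` with a weight `w ≥ 0`.  Since `ψ(s)` is a positive real number
for real `s`, the division in `[0, +∞]` makes it `+∞` when `w = 0`. -/
def tailTerm (φ : Measure ℝ) (ψ : ℂ → ℂ) (w s : ℝ) : ℝ≥0∞ :=
  ENNReal.ofReal (ψ s).re / ENNReal.ofReal (w * Real.sqrt (iteratedDeriv 2 (realExponent φ) s))

end ModPhi

end

/-!
The rate function `F` is convex, nonnegative and vanishes only at the mean `m = η'(0)` of `φ`, so it
increases strictly away from `m` wherever it is finite (`legendre_lt_of_abs_lt`). On either side of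
`m` it is therefore minimal, among the points of `closure B`, at the point closest to `m`, and there
are one or two minimizers (`encard_minimizers`). If `m ∈ closure B`, then `m` is the minimizer,
`h m = 0` and the bound is infinite. Otherwise `B` is covered by two half-lines not containing `m`.
A half-line whose end point has a rate exceeding `F(B)` is negligible by Chernoff's inequality
(`ModConverges.tendsto_side_zero`), which also settles sets that are not admissible. A half-line
ending at a minimizer `a` requires a sharp upper bound.

For the sharp bound, let `h` be the parameter with `η'(h) = a`, and let `d` be a mesh with the sign
of `h`. Tilting the law of `Xₙ` by `h` turns the probability of the half-line into
`exp (-tₙ h a) 𝔼[exp (h Xₙ)]`, which is about `ψ(h) exp (-tₙ F(a))`, times the integral of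
`exp (-l Y) 1_{Y ≥ 0}` under the tilted law, where `l = h d` and `Y = (Xₙ - tₙ a) / d`
(`measureReal_half_line_eq`). This function of `Y` is replaced by its Graham–Vaaler majorant, which
has bandwidth `2π` and integral `1 / (1 - exp (-l))` (`indicator_exp_le_expMajorant`), so that only
the characteristic function of `Y` on `[0, 2π]` matters (`exists_integral_indicator_exp_le`).
There mod-`φ` convergence controls it uniformly. The main contribution comes from the origin, by
Laplace's method (`eventually_laplace_le`), once the tilted characteristic functions of `φ` are
known to have modulus less than `1` elsewhere, except possibly at the end of the interval, where the
weights vanish. This is where lattices enter (`exists_quadratic_decay`): for a lattice law of span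
`1` the mesh `|d| = 1` is allowed and yields the constant `1 / (1 - exp (-|h|))`, whereas for a
non-lattice law every mesh is allowed, and `|d| / (1 - exp (-|h d|))` tends to `1 / |h|` as the mesh
tends to `0`.
-/

namespace ModPhi

/-! ### The Graham–Vaaler majorant -/

/-- The Fejér kernel of bandwidth `2π`, given by its Fourier transform `(1 - |τ|)₊`; off `0` it is
`(sin (π x) / (π x)) ^ 2`. -/
noncomputable def fejer (x : ℝ) : ℝ :=
  ∫ τ in (0 : ℝ)..1, 2 * (1 - τ) * Real.cos (2 * Real.pi * x * τ)

/-- The odd kernel of bandwidth `2π` which off `0` is `(sin (π x) / π) ^ 2 / x`. -/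
noncomputable def conjFejer (x : ℝ) : ℝ :=
  1 / Real.pi * ∫ τ in (0 : ℝ)..1, Real.sin (2 * Real.pi * x * τ)

lemma fejer_eq {x : ℝ} (hx : x ≠ 0) :
    fejer x = (Real.sin (Real.pi * x) / Real.pi) ^ 2 / x ^ 2 := by
  have hw : 2 * Real.pi * x ≠ 0 := by have := Real.pi_ne_zero; positivity
  set w := 2 * Real.pi * x with hw'
  have h : ∀ τ ∈ Set.uIcc (0 : ℝ) 1, HasDerivAt
      (fun τ => 2 * (1 - τ) * Real.sin (w * τ) / w - 2 * Real.cos (w * τ) / w ^ 2)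
      (2 * (1 - τ) * Real.cos (w * τ)) τ := by
    intro τ _
    have h1 : HasDerivAt (fun τ => w * τ) w τ := by simpa using (hasDerivAt_id τ).const_mul w
    have h2 : HasDerivAt (fun τ : ℝ => 2 * (1 - τ)) (-2) τ := by
      simpa using ((hasDerivAt_id τ).const_sub 1).const_mul 2
    refine (((h2.mul h1.sin).div_const w).sub
      ((h1.cos.const_mul 2).div_const (w ^ 2))).congr_deriv ?_
    field_simp
    ring
  rw [fejer, intervalIntegral.integral_eq_sub_of_hasDerivAt h
    (Continuous.intervalIntegrable (by fun_prop) _ _)]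
  have h3 : Real.cos w = 1 - 2 * Real.sin (Real.pi * x) ^ 2 := by
    rw [hw', mul_assoc, Real.cos_two_mul, Real.cos_sq']; ring
  have := Real.pi_ne_zero
  simp only [mul_one, sub_self, mul_zero, zero_mul, zero_div, Real.sin_zero, Real.cos_zero, h3]
  rw [hw']
  field_simp
  ring

lemma conjFejer_eq {x : ℝ} (hx : x ≠ 0) :
    conjFejer x = (Real.sin (Real.pi * x) / Real.pi) ^ 2 / x := by
  have hw : 2 * Real.pi * x ≠ 0 := by have := Real.pi_ne_zero; positivity
  set w := 2 * Real.pi * x with hw'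
  have h : ∀ τ ∈ Set.uIcc (0 : ℝ) 1, HasDerivAt
      (fun τ => - Real.cos (w * τ) / w) (Real.sin (w * τ)) τ := by
    intro τ _
    have h1 : HasDerivAt (fun τ => w * τ) w τ := by simpa using (hasDerivAt_id τ).const_mul w
    refine (h1.cos.neg.div_const w).congr_deriv ?_
    field_simp
  rw [conjFejer, intervalIntegral.integral_eq_sub_of_hasDerivAt h
    (Continuous.intervalIntegrable (by fun_prop) _ _)]
  have h3 : Real.cos w = 1 - 2 * Real.sin (Real.pi * x) ^ 2 := by
    rw [hw', mul_assoc, Real.cos_two_mul, Real.cos_sq']; ring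
  have := Real.pi_ne_zero
  simp only [mul_one, mul_zero, Real.cos_zero, h3]
  rw [hw']
  field_simp
  ring

lemma continuous_fejer : Continuous fejer :=
  intervalIntegral.continuous_parametric_intervalIntegral_of_continuous' (by fun_prop) _ _

lemma continuous_conjFejer : Continuous conjFejer :=
  continuous_const.mul <|
    intervalIntegral.continuous_parametric_intervalIntegral_of_continuous' (by fun_prop) _ _

lemma abs_fejer_le (x : ℝ) : |fejer x| ≤ 2 := by
  have := intervalIntegral.norm_integral_le_of_norm_le_const (a := (0 : ℝ)) (b := 1) (C := 2)
    (f := fun τ => 2 * (1 - τ) * Real.cos (2 * Real.pi * x * τ)) (by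
      intro τ hτ
      rw [Set.uIoc_of_le zero_le_one] at hτ
      rw [norm_mul, Real.norm_eq_abs, Real.norm_eq_abs,
        abs_of_nonneg (by linarith [hτ.2] : (0 : ℝ) ≤ 2 * (1 - τ))]
      nlinarith [Real.abs_cos_le_one (2 * Real.pi * x * τ), hτ.1, hτ.2,
        abs_nonneg (Real.cos (2 * Real.pi * x * τ))])
  simpa [fejer] using this

lemma abs_conjFejer_le (x : ℝ) : |conjFejer x| ≤ 1 := by
  have := intervalIntegral.norm_integral_le_of_norm_le_const (a := (0 : ℝ)) (b := 1) (C := 1)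
    (f := fun τ => Real.sin (2 * Real.pi * x * τ)) (by
      intro τ hτ
      exact Real.abs_sin_le_one _)
  have h2 : |1 / Real.pi| ≤ 1 := by
    rw [abs_of_pos (by positivity), div_le_one Real.pi_pos]; linarith [Real.pi_gt_three]
  rw [conjFejer, abs_mul]
  calc _ ≤ 1 * 1 := mul_le_mul h2 (by simpa using this) (abs_nonneg _) zero_le_one
    _ = 1 := one_mul 1

/-- The Graham–Vaaler majorant of `x ↦ exp (-l x) 1_{x ≥ 0}`: the function of bandwidth `2π` which
interpolates `exp (-l x)` to second order at the positive integers, vanishes to second order at the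
negative integers, and takes the value `1` at `0`. -/
noncomputable def expMajorant (l x : ℝ) : ℝ :=
  ∑' k : ℕ, Real.exp (-l * k) * (fejer (x - k) - l * (conjFejer (x - k) - conjFejer x))

lemma summable_exp_neg_mul {l : ℝ} (hl : 0 < l) : Summable fun k : ℕ => Real.exp (-l * k) := by
  simpa [mul_comm] using Real.summable_exp_nat_mul_iff.mpr (by linarith : -l < 0)

lemma norm_expMajorant_term_le {l : ℝ} (hl : 0 < l) (x : ℝ) (k : ℕ) :
    ‖Real.exp (-l * k) * (fejer (x - k) - l * (conjFejer (x - k) - conjFejer x))‖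
      ≤ Real.exp (-l * k) * (2 + l * 2) := by
  rw [norm_mul, Real.norm_of_nonneg (Real.exp_pos _).le]
  refine mul_le_mul_of_nonneg_left ?_ (Real.exp_pos _).le
  have h1 := abs_le.1 (abs_fejer_le (x - k))
  have h2 := abs_le.1 (abs_conjFejer_le (x - k))
  have h3 := abs_le.1 (abs_conjFejer_le x)
  rw [Real.norm_eq_abs, abs_le]
  constructor <;> nlinarith

lemma continuous_expMajorant {l : ℝ} (hl : 0 < l) : Continuous (expMajorant l) := by
  have := continuous_fejer
  have := continuous_conjFejer
  exact continuous_tsum (fun k => by fun_prop) ((summable_exp_neg_mul hl).mul_right _)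
    fun k x => norm_expMajorant_term_le hl x k

lemma hasSum_expMajorant {l : ℝ} (hl : 0 < l) (x : ℝ) :
    HasSum (fun k : ℕ => Real.exp (-l * k) *
      (fejer (x - k) - l * (conjFejer (x - k) - conjFejer x))) (expMajorant l x) :=
  (Summable.of_norm_bounded ((summable_exp_neg_mul hl).mul_right _)
    (norm_expMajorant_term_le hl x)).hasSum

/-- Off the integers the translates of the Fejér kernel sum to `1`: this is Parseval's identity for
`τ ↦ exp (2π i x τ)` on `[0, 1]`. -/
lemma hasSum_fejer_translates {x : ℝ} (hx : ∀ n : ℤ, x ≠ n) :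
    HasSum (fun n : ℤ => (Real.sin (Real.pi * x) / Real.pi) ^ 2 / (x - n) ^ 2) 1 := by
  have hL2 : MemLp (fun τ : ℝ => Complex.exp (2 * Real.pi * Complex.I * x * τ)) 2
      (volume.restrict (Set.Ioc 0 1)) := by
    refine MemLp.of_bound (C := 1) (Continuous.aestronglyMeasurable (by fun_prop)) (ae_of_all _ ?_)
    intro τ
    rw [Complex.norm_exp]
    simp
  have h := hasSum_sq_fourierCoeffOn zero_lt_one hL2
  convert h using 1
  · ext n
    have hn : x - n ≠ 0 := sub_ne_zero.2 (hx n)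
    have hc : (2 * Real.pi * Complex.I * (x - n) : ℂ) ≠ 0 := by
      have := Real.pi_ne_zero
      have h2 : ((x : ℂ) - n) ≠ 0 := by exact_mod_cast hn
      simp [this, h2]
    have hcoef : fourierCoeffOn zero_lt_one
        (fun τ : ℝ => Complex.exp (2 * Real.pi * Complex.I * x * τ)) n =
        (Complex.exp (2 * Real.pi * Complex.I * (x - n)) - 1) /
          (2 * Real.pi * Complex.I * (x - n)) := by
      rw [fourierCoeffOn_eq_integral]
      rw [intervalIntegral.integral_congr
        (g := fun τ : ℝ => Complex.exp (2 * Real.pi * Complex.I * (x - n) * τ))]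
      · rw [integral_exp_mul_complex hc]
        simp
      · intro τ _
        simp only [fourier_coe_apply, smul_eq_mul, ← Complex.exp_add]
        congr 1
        push_cast
        ring
    rw [hcoef, norm_div, div_pow]
    have e1 : (2 * Real.pi * Complex.I * (x - n) : ℂ) =
        Complex.I * (2 * Real.pi * (x - n) : ℝ) := by
      push_cast; ring
    rw [e1, Complex.norm_exp_I_mul_ofReal_sub_one]
    have e2 : 2 * Real.pi * (x - n) / 2 = Real.pi * x - n * Real.pi := by ring
    rw [e2, Real.sin_sub_int_mul_pi]
    have := Real.pi_ne_zero
    have e3 : ((-1 : ℝ) ^ n) ^ 2 = 1 := by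
      rw [← zpow_natCast, ← zpow_mul, mul_comm, zpow_mul]; simp
    have e4 : ‖Complex.I * ((2 * Real.pi * (x - n) : ℝ) : ℂ)‖ ^ 2 =
        (2 * Real.pi * (x - n)) ^ 2 := by
      rw [norm_mul, Complex.norm_I, one_mul, Complex.norm_real, Real.norm_eq_abs, sq_abs]
    rw [div_pow _ ‖_‖, e4, Real.norm_eq_abs, sq_abs, mul_pow 2 ((-1) ^ n * _),
      mul_pow _ (Real.sin _), e3]
    field_simp
  · rw [intervalIntegral.integral_congr (g := fun _ => (1 : ℝ))]
    · simp
    · intro τ _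
      simp [Complex.norm_exp]

/-- Concavity of `v ↦ 1 - exp (-v)` on `[0, l]`. -/
lemma le_mul_one_sub_exp {l v : ℝ} (hl : 0 < l) (hv : 0 ≤ v) (hvl : v ≤ l) :
    v ≤ l / (1 - Real.exp (-l)) * (1 - Real.exp (-v)) := by
  have hq : 0 < 1 - Real.exp (-l) := by
    have := Real.exp_lt_one_iff.2 (by linarith : -l < 0); linarith
  have h := convexOn_exp.2 (Set.mem_univ 0) (Set.mem_univ (-l))
    (show 0 ≤ 1 - v / l by rw [sub_nonneg, div_le_one hl]; exact hvl)
    (show 0 ≤ v / l by positivity) (by ring)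
  have e : (1 - v / l) • (0 : ℝ) + (v / l) • (-l) = -v := by
    simp only [smul_eq_mul]; field_simp; ring
  rw [e] at h
  simp only [smul_eq_mul, Real.exp_zero, mul_one] at h
  rw [div_mul_eq_mul_div, le_div_iff₀ hq]
  have h2 : l * (v / l) = v := by field_simp
  nlinarith

/-- The telescoping bound that controls the Hermite interpolation of `exp (-l x)` at the
nonnegative integers; both sides are integrals over `[0, l]` against `exp ((v - l) d)`. -/
lemma hermite_term_le {l d : ℝ} (hl : 0 < l) (hd : d ≠ 0) (hd1 : d ≠ 1) :
    l / d - (1 - Real.exp (-l * d)) / d ^ 2 ≤ l / (1 - Real.exp (-l)) *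
      ((1 - Real.exp (-l * d)) / d - (Real.exp (-l) - Real.exp (-l * d)) / (d - 1)) := by
  have hd1' : d - 1 ≠ 0 := sub_ne_zero.2 hd1
  have i1 : ∫ v in (0 : ℝ)..l, v * Real.exp ((v - l) * d) =
      l / d - (1 - Real.exp (-l * d)) / d ^ 2 := by
    rw [intervalIntegral.integral_eq_sub_of_hasDerivAt
      (f := fun v => v * Real.exp ((v - l) * d) / d - Real.exp ((v - l) * d) / d ^ 2) _
      (Continuous.intervalIntegrable (by fun_prop) _ _)]
    · simp; ring
    · intro v _
      have h1 : HasDerivAt (fun v => Real.exp ((v - l) * d)) (Real.exp ((v - l) * d) * d) v := by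
        simpa using (((hasDerivAt_id v).sub_const l).mul_const d).exp
      refine ((((hasDerivAt_id v).mul h1).div_const d).sub (h1.div_const (d ^ 2))).congr_deriv ?_
      simp only [id]
      field_simp
      ring
  have i2 : ∫ v in (0 : ℝ)..l, (1 - Real.exp (-v)) * Real.exp ((v - l) * d) =
      (1 - Real.exp (-l * d)) / d - (Real.exp (-l) - Real.exp (-l * d)) / (d - 1) := by
    rw [intervalIntegral.integral_eq_sub_of_hasDerivAt
      (f := fun v => Real.exp ((v - l) * d) / d - Real.exp (-l * d + v * (d - 1)) / (d - 1)) _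
      (Continuous.intervalIntegrable (by fun_prop) _ _)]
    · have : -l * d + l * (d - 1) = -l := by ring
      simp only [sub_self, zero_mul, Real.exp_zero, this, add_zero, zero_sub]
      ring
    · intro v _
      have h1 : HasDerivAt (fun v => Real.exp ((v - l) * d)) (Real.exp ((v - l) * d) * d) v := by
        simpa using (((hasDerivAt_id v).sub_const l).mul_const d).exp
      have h2 : HasDerivAt (fun v => Real.exp (-l * d + v * (d - 1)))
          (Real.exp (-l * d + v * (d - 1)) * (d - 1)) v := by
        simpa using (((hasDerivAt_id v).mul_const (d - 1)).const_add (-l * d)).exp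
      refine ((h1.div_const d).sub (h2.div_const (d - 1))).congr_deriv ?_
      rw [mul_div_cancel_right₀ _ hd, mul_div_cancel_right₀ _ hd1', sub_mul 1, one_mul,
        ← Real.exp_add]
      congr 2
      ring
  rw [← i1, ← i2, ← intervalIntegral.integral_const_mul]
  refine intervalIntegral.integral_mono_on hl.le (Continuous.intervalIntegrable (by fun_prop) _ _)
    (Continuous.intervalIntegrable (by fun_prop) _ _) fun v hv => ?_
  rw [← mul_assoc]
  exact mul_le_mul_of_nonneg_right (le_mul_one_sub_exp hl hv.1 hv.2) (Real.exp_pos _).le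

lemma hasSum_exp_neg_mul {l : ℝ} (hl : 0 < l) :
    HasSum (fun k : ℕ => Real.exp (-l * k)) (1 - Real.exp (-l))⁻¹ := by
  have := hasSum_geometric_of_lt_one (Real.exp_pos (-l)).le (Real.exp_lt_one_iff.2 (by linarith))
  convert this using 2 with k
  rw [← Real.exp_nat_mul]; ring_nf

lemma one_le_div_one_sub_exp {l : ℝ} (hl : 0 < l) : 1 ≤ l / (1 - Real.exp (-l)) := by
  have hq : 0 < 1 - Real.exp (-l) := by
    have := Real.exp_lt_one_iff.2 (by linarith : -l < 0); linarith
  rw [le_div_iff₀ hq]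
  linarith [Real.add_one_le_exp (-l)]

lemma div_mul_exp_le_one {l : ℝ} (hl : 0 < l) : l / (1 - Real.exp (-l)) * Real.exp (-l) ≤ 1 := by
  have hq : 0 < 1 - Real.exp (-l) := by
    have := Real.exp_lt_one_iff.2 (by linarith : -l < 0); linarith
  rw [div_mul_eq_mul_div, div_le_one hq]
  have h1 := Real.add_one_le_exp l
  have h2 : Real.exp l * Real.exp (-l) = 1 := by rw [← Real.exp_add]; simp
  nlinarith [Real.exp_pos (-l)]

lemma sq_sin_div_pi_sub_nat (x : ℝ) (k : ℕ) :
    (Real.sin (Real.pi * (x - k)) / Real.pi) ^ 2 = (Real.sin (Real.pi * x) / Real.pi) ^ 2 := by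
  rw [mul_sub, mul_comm Real.pi (k : ℝ), Real.sin_sub_nat_mul_pi]
  have e3 : ((-1 : ℝ) ^ k) ^ 2 = 1 := by rw [← pow_mul, mul_comm, pow_mul]; simp
  rw [div_pow, mul_pow, e3, one_mul, div_pow]

/-- On the negative axis each term of the series is bounded below by a term which telescopes, up to
a geometric term; the partial sums of these lower bounds tend to `0`. -/
lemma expMajorant_nonneg_of_neg {l x : ℝ} (hl : 0 < l) (hx : x < 0) : 0 ≤ expMajorant l x := by
  obtain ⟨y, rfl⟩ : ∃ y, x = -y := ⟨-x, by ring⟩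
  have hy : 0 < y := by linarith
  set s := (Real.sin (Real.pi * -y) / Real.pi) ^ 2 with hs
  set c := l / (1 - Real.exp (-l)) with hc
  have hterm : ∀ k : ℕ, s * (c * (Real.exp (-l * k) / (y + k)
      - Real.exp (-l * (k + 1 : ℕ)) / (y + (k + 1 : ℕ))) - l * Real.exp (-l * k) / y) ≤
      Real.exp (-l * k) * (fejer (-y - k) - l * (conjFejer (-y - k) - conjFejer (-y))) := by
    intro k
    have hyk : 0 < y + k := by positivity
    have hsk : (Real.sin (Real.pi * (-y - k)) / Real.pi) ^ 2 = s := sq_sin_div_pi_sub_nat _ _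
    rw [fejer_eq (by linarith), conjFejer_eq (by linarith), conjFejer_eq (by linarith), hsk, ← hs]
    have hE : Real.exp (-l * (k + 1 : ℕ)) = Real.exp (-l * k) * Real.exp (-l) := by
      rw [← Real.exp_add]; push_cast; ring_nf
    rw [hE]
    have hmain : c * (1 / (y + k) - Real.exp (-l) / (y + k + 1)) ≤
        1 / (y + k) ^ 2 + l / (y + k) := by
      have hcl : c * (1 - Real.exp (-l)) = l := by
        rw [hc, div_mul_cancel₀]
        have := Real.exp_lt_one_iff.2 (by linarith : -l < 0); linarith
      have : c * (1 / (y + k) - Real.exp (-l) / (y + k + 1)) =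
          c * (1 - Real.exp (-l)) / (y + k) +
            c * Real.exp (-l) * (1 / ((y + k) * (y + k + 1))) := by
        field_simp; ring
      rw [this, hcl, add_comm]
      have h1 : 1 / ((y + k) * (y + k + 1)) ≤ 1 / (y + k) ^ 2 :=
        one_div_le_one_div_of_le (by positivity) (by nlinarith)
      have h2 := div_mul_exp_le_one hl
      have h3 : 0 < 1 / ((y + k) * (y + k + 1)) := by positivity
      rw [← hc] at h2
      nlinarith
    have h4 : 0 ≤ s * Real.exp (-l * k) := by positivity
    have h5 := mul_le_mul_of_nonneg_left hmain h4
    calc _ = s * Real.exp (-l * k) * (c * (1 / (y + k) - Real.exp (-l) / (y + k + 1)))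
          - s * Real.exp (-l * k) * (l / y) := by push_cast; ring
      _ ≤ s * Real.exp (-l * k) * (1 / (y + k) ^ 2 + l / (y + k))
          - s * Real.exp (-l * k) * (l / y) := by linarith
      _ = _ := by
        have e1 : (-y - (k : ℝ)) = -(y + k) := by ring
        rw [e1]; field_simp; ring
  have hlim : Tendsto (fun N : ℕ => s * (c * (1 / y - Real.exp (-l * N) / (y + N))
      - ∑ k ∈ Finset.range N, l * Real.exp (-l * k) / y)) atTop (𝓝 0) := by
    have h1 : Tendsto (fun N : ℕ => Real.exp (-l * N) / (y + N)) atTop (𝓝 0) := by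
      refine squeeze_zero (g := fun N : ℕ => Real.exp (-l * N) / y)
        (fun N => by positivity) (fun N => ?_)
        (by simpa using (summable_exp_neg_mul hl).tendsto_atTop_zero.div_const y)
      have : (0 : ℝ) ≤ N := Nat.cast_nonneg N
      exact div_le_div_of_nonneg_left (Real.exp_pos _).le hy (by linarith)
    have h2 : Tendsto (fun N : ℕ => ∑ k ∈ Finset.range N, l * Real.exp (-l * k) / y) atTop
        (𝓝 (c * (1 / y - 0))) := by
      have := (((hasSum_exp_neg_mul hl).mul_left l).div_const y).tendsto_sum_nat
      convert this using 2
      rw [hc]; ring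
    simpa using (((tendsto_const_nhds (x := 1 / y)).sub h1).const_mul c |>.sub h2).const_mul s
  refine le_of_tendsto_of_tendsto' hlim (hasSum_expMajorant hl (-y)).tendsto_sum_nat fun N => ?_
  refine le_trans (le_of_eq ?_) (Finset.sum_le_sum fun k _ => hterm k)
  rw [← Finset.mul_sum, Finset.sum_sub_distrib, ← Finset.mul_sum, Finset.sum_range_sub']
  simp

/-- Off the integers, the majorant is compared with `exp (-l x)` times the Parseval sum of
`hasSum_fejer_translates`. Its terms at `n ≥ 0` are matched with the terms of the majorant, the
difference being controlled by the telescoping bound `hermite_term_le`; those at `n < 0` sum to at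
most `(sin (π x) / π) ^ 2 / x`, which the telescoped boundary term covers because
`1 ≤ l / (1 - exp (-l))`. -/
lemma exp_le_expMajorant_of_pos {l x : ℝ} (hl : 0 < l) (hx : 0 < x) (hxn : ∀ n : ℤ, x ≠ n) :
    Real.exp (-l * x) ≤ expMajorant l x := by
  set s := (Real.sin (Real.pi * x) / Real.pi) ^ 2 with hs
  set c := l / (1 - Real.exp (-l)) with hc
  set E := Real.exp (-l * x) with hE
  have hxk : ∀ k : ℕ, x - k ≠ 0 := fun k => sub_ne_zero.2 (by exact_mod_cast hxn k)
  set ρ : ℕ → ℝ := fun k => (Real.exp (-l * k) - E) / (x - k) with hρ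
  have hs0 : 0 ≤ s := by positivity
  -- the two halves of Parseval's sum
  have hsum := hasSum_fejer_translates hxn
  rw [← hs] at hsum
  have hsumA : Summable fun k : ℕ => s / (x - k) ^ 2 := by
    have := hsum.summable.comp_injective (i := fun k : ℕ => (k : ℤ)) Nat.cast_injective
    simpa [Function.comp_def] using this
  have hsumB : Summable fun k : ℕ => s / (x + (k + 1)) ^ 2 := by
    have := hsum.summable.comp_injective (i := fun k : ℕ => -((k : ℤ) + 1))
      (fun a b h => by simpa using h)
    refine this.congr fun k => ?_
    simp only [Function.comp]
    push_cast
    ring_nf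
  have hAB : (∑' k : ℕ, s / (x - k) ^ 2) + ∑' k : ℕ, s / (x + (k + 1)) ^ 2 = 1 := by
    have h1 := HasSum.of_nat_of_neg_add_one (f := fun n : ℤ => s / (x - n) ^ 2)
      (m := ∑' k : ℕ, s / (x - k) ^ 2) (m' := ∑' k : ℕ, s / (x + (k + 1)) ^ 2)
      (by simpa using hsumA.hasSum)
      (by
        convert hsumB.hasSum using 2 with k
        push_cast
        ring_nf)
    exact h1.unique hsum
  have hB : ∑' k : ℕ, s / (x + (k + 1)) ^ 2 ≤ s / x := by
    refine Real.tsum_le_of_sum_range_le (fun k => by positivity) fun N => ?_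
    have : ∑ k ∈ Finset.range N, s / (x + (k + 1)) ^ 2 ≤
        ∑ k ∈ Finset.range N, (s / (x + k) - s / (x + (k + 1 : ℕ))) := by
      refine Finset.sum_le_sum fun k _ => ?_
      have h0 : 0 < x + k := by positivity
      have : s / (x + k) - s / (x + (k + 1 : ℕ)) = s / ((x + k) * (x + (k + 1))) := by
        push_cast
        have : x + (k + 1) ≠ 0 := by positivity
        field_simp
        ring
      rw [this]
      apply div_le_div_of_nonneg_left hs0 (by positivity)
      nlinarith
    rw [Finset.sum_range_sub'] at this
    refine this.trans ?_
    have h0 : 0 ≤ s / (x + N) := by positivity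
    simpa using h0
  have hterm : ∀ k : ℕ, E * (s / (x - k) ^ 2) + s * (l * Real.exp (-l * k) / x
      - c * (ρ k - ρ (k + 1))) ≤
      Real.exp (-l * k) * (fejer (x - k) - l * (conjFejer (x - k) - conjFejer x)) := by
    intro k
    have hd := hxk k
    have hd1 : x - k ≠ 1 := by
      have := hxk (k + 1)
      intro h
      apply this
      push_cast
      linarith
    have hsk : (Real.sin (Real.pi * (x - k)) / Real.pi) ^ 2 = s := sq_sin_div_pi_sub_nat _ _
    rw [fejer_eq hd, conjFejer_eq hd, conjFejer_eq hx.ne', hsk, ← hs]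
    have h := mul_le_mul_of_nonneg_left (hermite_term_le hl hd hd1)
      (by positivity : 0 ≤ s * Real.exp (-l * k))
    have hEk : Real.exp (-l * k) * Real.exp (-l * (x - k)) = E := by
      rw [← Real.exp_add, hE]; ring_nf
    have hEk1 : Real.exp (-l * k) * Real.exp (-l) = Real.exp (-l * (k + 1 : ℕ)) := by
      rw [← Real.exp_add]; push_cast; ring_nf
    have r1 : Real.exp (-l * k) * ((1 - Real.exp (-l * (x - k))) / (x - k)
        - (Real.exp (-l) - Real.exp (-l * (x - k))) / (x - k - 1)) = ρ k - ρ (k + 1) := by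
      simp only [hρ]
      rw [← hEk1, ← hEk]
      push_cast
      rw [sub_sub x (k : ℝ) 1]
      ring
    have r2 : Real.exp (-l * k) * (l / (x - k) - (1 - Real.exp (-l * (x - k))) / (x - k) ^ 2) =
        l * Real.exp (-l * k) / (x - k) - (Real.exp (-l * k) - E) / (x - k) ^ 2 := by
      rw [← hEk]; ring
    have h' : s * (l * Real.exp (-l * k) / (x - k) - (Real.exp (-l * k) - E) / (x - k) ^ 2) ≤
        s * (c * (ρ k - ρ (k + 1))) := by
      rw [← r1, ← r2]
      refine le_trans (le_of_eq (by ring)) (h.trans (le_of_eq (by rw [← hc]; ring)))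
    refine le_trans (sub_le_sub_left h' (E * (s / (x - k) ^ 2) + s * (l * Real.exp (-l * k) / x))
      |>.trans' (le_of_eq (by ring))) (le_of_eq (by ring))
  have hρ0 : Tendsto ρ atTop (𝓝 0) := by
    have h1 : Tendsto (fun k : ℕ => Real.exp (-l * k) - E) atTop (𝓝 (0 - E)) :=
      (summable_exp_neg_mul hl).tendsto_atTop_zero.sub_const E
    have h2 : Tendsto (fun k : ℕ => x - (k : ℝ)) atTop atBot :=
      tendsto_const_nhds.add_atBot (tendsto_neg_atTop_atBot.comp tendsto_natCast_atTop_atTop)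
    exact h1.div_atBot h2
  have hlim : Tendsto (fun N : ℕ => ∑ k ∈ Finset.range N, E * (s / (x - k) ^ 2)
      + s * (∑ k ∈ Finset.range N, l * Real.exp (-l * k) / x - c * (ρ 0 - ρ N))) atTop
      (𝓝 (E * (∑' k : ℕ, s / (x - k) ^ 2) + s * (c / x - c * (ρ 0 - 0)))) := by
    refine ((hsumA.hasSum.mul_left E).tendsto_sum_nat).add (Tendsto.const_mul s (Tendsto.sub ?_
      ((tendsto_const_nhds.sub hρ0).const_mul c)))
    have := (((hasSum_exp_neg_mul hl).mul_left l).div_const x).tendsto_sum_nat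
    convert this using 2
    rw [hc]; ring
  have hle := le_of_tendsto_of_tendsto' hlim (hasSum_expMajorant hl x).tendsto_sum_nat fun N => by
    refine le_trans (le_of_eq ?_) (Finset.sum_le_sum fun k _ => hterm k)
    rw [Finset.sum_add_distrib, ← Finset.mul_sum, ← Finset.mul_sum, Finset.sum_sub_distrib,
      ← Finset.mul_sum, Finset.sum_range_sub']
  refine le_trans ?_ hle
  have hc1 : 1 ≤ c := one_le_div_one_sub_exp hl
  have hE0 : 0 < E := Real.exp_pos _
  have hρ00 : ρ 0 = (1 - E) / x := by simp [hρ]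
  have h5 : s * (c / x - c * (ρ 0 - 0)) = c * (E * (s / x)) := by rw [hρ00]; ring
  have h6 : E * (s / x) ≤ c * (E * (s / x)) := le_mul_of_one_le_left (by positivity) hc1
  rw [h5]
  have h7 := mul_le_mul_of_nonneg_left hB hE0.le
  have h8 : E = E * (∑' k : ℕ, s / (x - k) ^ 2) + E * ∑' k : ℕ, s / (x + (k + 1)) ^ 2 := by
    rw [← mul_add, hAB, mul_one]
  linarith

/-- The Graham–Vaaler inequality: `expMajorant l` is a majorant of `x ↦ exp (-l x) 1_{x ≥ 0}`. At
the integers it follows from the case of non-integers by right continuity. -/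
theorem indicator_exp_le_expMajorant {l : ℝ} (hl : 0 < l) (x : ℝ) :
    (Set.Ici (0 : ℝ)).indicator (fun x => Real.exp (-l * x)) x ≤ expMajorant l x := by
  have key : ∀ᶠ y in 𝓝[>] x, (Set.Ici (0 : ℝ)).indicator (fun x => Real.exp (-l * x)) x *
      Real.exp (-l * (y - x)) ≤ expMajorant l y := by
    have h1 : ∀ᶠ y : ℝ in 𝓝[>] x, y < ⌊x⌋ + 1 :=
      nhdsWithin_le_nhds (eventually_lt_nhds (Int.lt_floor_add_one x))
    filter_upwards [h1, self_mem_nhdsWithin] with y hy hxy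
    have hyn : ∀ n : ℤ, y ≠ n := by
      rintro n rfl
      have h2 : n < ⌊x⌋ + 1 := by exact_mod_cast hy
      have h3 : ⌊x⌋ < n := by exact_mod_cast (Int.floor_le x).trans_lt hxy
      omega
    by_cases hx : 0 ≤ x
    · rw [Set.indicator_of_mem (by simpa using hx), ← Real.exp_add]
      refine le_trans (le_of_eq ?_) (exp_le_expMajorant_of_pos hl (hx.trans_lt hxy) hyn)
      ring_nf
    · rw [Set.indicator_of_notMem (by simpa using hx), zero_mul]
      rcases lt_or_ge y 0 with h | h
      · exact expMajorant_nonneg_of_neg hl h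
      · have : y ≠ 0 := by simpa using hyn 0
        exact (Real.exp_pos _).le.trans (exp_le_expMajorant_of_pos hl (h.lt_of_ne' this) hyn)
  have hlim1 : Tendsto (fun y => (Set.Ici (0 : ℝ)).indicator (fun x => Real.exp (-l * x)) x *
      Real.exp (-l * (y - x))) (𝓝[>] x)
      (𝓝 ((Set.Ici (0 : ℝ)).indicator (fun x => Real.exp (-l * x)) x * Real.exp (-l * (x - x)))) :=
    (Continuous.tendsto (by fun_prop) x).mono_left nhdsWithin_le_nhds
  have hlim2 := ((continuous_expMajorant hl).tendsto x).mono_left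
    (nhdsWithin_le_nhds (s := Set.Ioi x))
  simpa using le_of_tendsto_of_tendsto hlim1 hlim2 key

/-! ### A smoothing inequality for characteristic functions -/

lemma integral_const_mul_exp_sub {μ : Measure ℝ} (ξ u : ℝ) (c : ℂ) :
    ∫ x, c * Complex.exp (ξ * (x - u) * Complex.I) ∂μ =
      c * Complex.exp (-(ξ * u) * Complex.I) * charFun μ ξ := by
  rw [charFun_apply_real, ← integral_const_mul]
  congr with x
  rw [mul_assoc c, ← Complex.exp_add]
  ring_nf

lemma integrable_exp_sub (μ : Measure ℝ) [IsFiniteMeasure μ] (ξ u : ℝ) :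
    Integrable (fun x : ℝ => Complex.exp (ξ * (x - u) * Complex.I)) μ := by
  refine Integrable.of_bound (C := 1) (Continuous.aestronglyMeasurable (by fun_prop))
    (ae_of_all _ fun x => ?_)
  rw [Complex.norm_exp]
  simp

lemma intervalIntegrable_norm_charFun_comp_mul (μ : Measure ℝ) [IsFiniteMeasure μ] (r a b : ℝ) :
    IntervalIntegrable (fun τ => ‖charFun μ (r * τ)‖) volume a b := by
  rw [intervalIntegrable_iff]
  have : IsFiniteMeasure (volume.restrict (Set.uIoc a b)) := ⟨by simp [Set.uIoc]⟩
  exact Integrable.of_bound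
    ((measurable_charFun.comp (measurable_const_mul r)).norm.aestronglyMeasurable)
    (μ.real Set.univ) (ae_of_all _ fun τ => by simpa using norm_charFun_le (r * τ))

lemma integral_cos_sub (μ : Measure ℝ) [IsFiniteMeasure μ] (ξ u : ℝ) :
    ∫ x, Real.cos (ξ * (x - u)) ∂μ = (Complex.exp (-(ξ * u) * Complex.I) * charFun μ ξ).re := by
  have h1 : ∫ x, Real.cos (ξ * (x - u)) ∂μ =
      (∫ x : ℝ, Complex.exp (ξ * (x - u) * Complex.I) ∂μ).re := by
    rw [← Complex.reCLM_apply, ← Complex.reCLM.integral_comp_comm (integrable_exp_sub μ ξ u)]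
    congr with x
    have : (ξ * (x - u) * Complex.I : ℂ) = ((ξ * (x - u) : ℝ) : ℂ) * Complex.I := by push_cast; rfl
    rw [this, Complex.reCLM_apply, Complex.exp_ofReal_mul_I_re]
  have h2 := integral_const_mul_exp_sub (μ := μ) ξ u 1
  simp only [one_mul] at h2
  rw [h1, h2]

lemma integral_cos_sub_le (μ : Measure ℝ) [IsFiniteMeasure μ] (ξ u : ℝ) :
    ∫ x, Real.cos (ξ * (x - u)) ∂μ ≤ ‖charFun μ ξ‖ := by
  rw [integral_cos_sub]
  refine (Complex.re_le_norm _).trans (le_of_eq ?_)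
  rw [norm_mul, Complex.norm_exp]
  simp

lemma abs_integral_sin_sub_sin_le (μ : Measure ℝ) [IsFiniteMeasure μ] (ξ u : ℝ) :
    |∫ x, (Real.sin (ξ * (x - u)) - Real.sin (ξ * x)) ∂μ| ≤
      ‖Complex.exp (Complex.I * ((-(ξ * u) : ℝ) : ℂ)) - 1‖ * ‖charFun μ ξ‖ := by
  have hi0 := integrable_exp_sub μ ξ 0
  have h1 : ∫ x, (Real.sin (ξ * (x - u)) - Real.sin (ξ * x)) ∂μ =
      (∫ x : ℝ, (Complex.exp (ξ * (x - u) * Complex.I) -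
        Complex.exp (ξ * (x - (0 : ℝ)) * Complex.I)) ∂μ).im := by
    have hd : Integrable (fun x : ℝ => Complex.exp (ξ * (x - u) * Complex.I) -
        Complex.exp (ξ * (x - (0 : ℝ)) * Complex.I)) μ := (integrable_exp_sub μ ξ u).sub hi0
    rw [← Complex.imCLM_apply, ← Complex.imCLM.integral_comp_comm hd]
    congr with x
    have h3 : (ξ * (x - u) * Complex.I : ℂ) = ((ξ * (x - u) : ℝ) : ℂ) * Complex.I := by
      push_cast; rfl
    have h4 : (ξ * (x - (0 : ℝ)) * Complex.I : ℂ) = ((ξ * x : ℝ) : ℂ) * Complex.I := by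
      push_cast; ring
    rw [h3, h4, Complex.imCLM_apply, Complex.sub_im, Complex.exp_ofReal_mul_I_im,
      Complex.exp_ofReal_mul_I_im]
  have h2 := integral_const_mul_exp_sub (μ := μ) ξ u 1
  have h5 := integral_const_mul_exp_sub (μ := μ) ξ 0 1
  simp only [one_mul] at h2 h5
  rw [h1, integral_sub (integrable_exp_sub μ ξ u) hi0, h2, h5, ← sub_mul]
  refine (Complex.abs_im_le_norm _).trans (le_of_eq ?_)
  rw [norm_mul]
  congr 2
  push_cast
  rw [mul_zero, neg_zero, zero_mul, Complex.exp_zero, mul_comm Complex.I]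

/-- The integrality of the shift `k` makes the multiplier vanish at `τ = 1` as well as at
`τ = 0`. -/
lemma norm_exp_sub_one_le_min (k : ℕ) {τ : ℝ} (h0 : 0 ≤ τ) (h1 : τ ≤ 1) :
    ‖Complex.exp (Complex.I * ((-(2 * Real.pi * τ * k) : ℝ) : ℂ)) - 1‖ ≤
      2 * Real.pi * k * min τ (1 - τ) := by
  have hp := Real.pi_pos
  rw [mul_min_of_nonneg _ _ (by positivity)]
  refine le_min ?_ ?_
  · refine Real.norm_exp_I_mul_ofReal_sub_one_le.trans (le_of_eq ?_)
    rw [Real.norm_eq_abs, abs_neg, abs_of_nonneg (by positivity)]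
    ring
  · have : Complex.exp (Complex.I * ((-(2 * Real.pi * τ * k) : ℝ) : ℂ)) =
        Complex.exp (Complex.I * ((2 * Real.pi * (1 - τ) * k : ℝ) : ℂ)) := by
      rw [Complex.exp_eq_exp_iff_exists_int]
      refine ⟨-k, ?_⟩
      push_cast
      ring
    rw [this]
    refine Real.norm_exp_I_mul_ofReal_sub_one_le.trans (le_of_eq ?_)
    have : 0 ≤ 1 - τ := by linarith
    rw [Real.norm_eq_abs, abs_of_nonneg (by positivity)]
    ring

lemma integral_fejer_sub_le (μ : Measure ℝ) [IsFiniteMeasure μ] (u : ℝ) :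
    ∫ x, fejer (x - u) ∂μ ≤
      ∫ τ in (0 : ℝ)..1, 2 * (1 - τ) * ‖charFun μ (2 * Real.pi * τ)‖ := by
  have hi : Integrable (Function.uncurry fun (τ x : ℝ) =>
      2 * (1 - τ) * Real.cos (2 * Real.pi * (x - u) * τ))
      ((volume.restrict (Set.uIoc 0 1)).prod μ) := by
    have h1 : Integrable (fun τ : ℝ => 2 * (1 - τ)) (volume.restrict (Set.uIoc 0 1)) :=
      intervalIntegrable_iff.1 (Continuous.intervalIntegrable (by fun_prop) _ _)
    refine (h1.comp_fst μ).mul_bdd (c := 1)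
      (g := fun p : ℝ × ℝ => Real.cos (2 * Real.pi * (p.2 - u) * p.1))
      (Continuous.aestronglyMeasurable (by fun_prop)) (ae_of_all _ fun p => ?_)
    exact Real.abs_cos_le_one _
  simp only [fejer]
  rw [← intervalIntegral_integral_swap hi]
  have hc : IntervalIntegrable (fun τ => ‖charFun μ (2 * Real.pi * τ)‖) volume 0 1 :=
    intervalIntegrable_norm_charFun_comp_mul μ _ 0 1
  refine intervalIntegral.integral_mono_on zero_le_one ?_ ?_ fun τ hτ => ?_
  · rw [intervalIntegrable_iff]
    exact hi.integral_prod_left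
  · exact hc.continuousOn_mul (by fun_prop)
  · rw [integral_const_mul]
    refine mul_le_mul_of_nonneg_left ?_ (by linarith [hτ.2])
    refine (le_of_eq ?_).trans (integral_cos_sub_le μ (2 * Real.pi * τ) u)
    congr with x
    ring_nf

lemma abs_integral_conjFejer_sub_le (μ : Measure ℝ) [IsFiniteMeasure μ] (k : ℕ) :
    |∫ x, (conjFejer (x - k) - conjFejer x) ∂μ| ≤
      2 * k * ∫ τ in (0 : ℝ)..1, min τ (1 - τ) * ‖charFun μ (2 * Real.pi * τ)‖ := by
  have hi : Integrable (Function.uncurry fun (τ x : ℝ) =>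
      Real.sin (2 * Real.pi * (x - k) * τ) - Real.sin (2 * Real.pi * x * τ))
      ((volume.restrict (Set.uIoc 0 1)).prod μ) := by
    have : IsFiniteMeasure (volume.restrict (Set.uIoc (0 : ℝ) 1)) := ⟨by simp [Set.uIoc]⟩
    refine Integrable.of_bound (C := 1 + 1)
      (Continuous.aestronglyMeasurable (by unfold Function.uncurry; fun_prop))
      (ae_of_all _ fun p => ?_)
    exact (norm_sub_le _ _).trans (add_le_add (Real.abs_sin_le_one _) (Real.abs_sin_le_one _))
  have hc : IntervalIntegrable (fun τ => ‖charFun μ (2 * Real.pi * τ)‖) volume 0 1 :=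
    intervalIntegrable_norm_charFun_comp_mul μ _ 0 1
  have e1 : ∫ x, (conjFejer (x - k) - conjFejer x) ∂μ = 1 / Real.pi * ∫ τ in (0 : ℝ)..1, ∫ x,
      (Real.sin (2 * Real.pi * (x - k) * τ) - Real.sin (2 * Real.pi * x * τ)) ∂μ := by
    rw [intervalIntegral_integral_swap hi, ← integral_const_mul]
    congr with x
    rw [intervalIntegral.integral_sub (Continuous.intervalIntegrable (by fun_prop) _ _)
      (Continuous.intervalIntegrable (by fun_prop) _ _), mul_sub, conjFejer, conjFejer]
  have e2 : ∀ τ ∈ Set.Icc (0 : ℝ) 1, |∫ x,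
      (Real.sin (2 * Real.pi * (x - k) * τ) - Real.sin (2 * Real.pi * x * τ)) ∂μ| ≤
      2 * Real.pi * k * (min τ (1 - τ) * ‖charFun μ (2 * Real.pi * τ)‖) := by
    intro τ hτ
    refine (le_of_eq ?_).trans ((abs_integral_sin_sub_sin_le μ (2 * Real.pi * τ) k).trans ?_)
    · congr 2 with x
      ring_nf
    · rw [← mul_assoc]
      exact mul_le_mul_of_nonneg_right (norm_exp_sub_one_le_min k hτ.1 hτ.2) (norm_nonneg _)
  have hp := Real.pi_pos
  rw [e1, abs_mul, abs_of_pos (by positivity : 0 < 1 / Real.pi)]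
  calc _ ≤ 1 / Real.pi * ∫ τ in (0 : ℝ)..1,
        2 * Real.pi * k * (min τ (1 - τ) * ‖charFun μ (2 * Real.pi * τ)‖) := by
        refine mul_le_mul_of_nonneg_left ?_ (by positivity)
        refine (intervalIntegral.abs_integral_le_integral_abs zero_le_one).trans ?_
        refine intervalIntegral.integral_mono_on zero_le_one ?_ ?_ e2
        · refine IntervalIntegrable.abs ?_
          rw [intervalIntegrable_iff]
          exact hi.integral_prod_left
        · exact (hc.continuousOn_mul (by fun_prop)).const_mul _
    _ = _ := by
      rw [intervalIntegral.integral_const_mul]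
      field_simp

lemma integrable_fejer_sub (μ : Measure ℝ) [IsFiniteMeasure μ] (u : ℝ) :
    Integrable (fun x => fejer (x - u)) μ :=
  Integrable.of_bound (C := 2)
    (continuous_fejer.comp (continuous_sub_right u)).aestronglyMeasurable
    (ae_of_all _ fun _ => abs_fejer_le _)

lemma integrable_conjFejer_sub (μ : Measure ℝ) [IsFiniteMeasure μ] (u : ℝ) :
    Integrable (fun x => conjFejer (x - u)) μ :=
  Integrable.of_bound (C := 1)
    (continuous_conjFejer.comp (continuous_sub_right u)).aestronglyMeasurable
    (ae_of_all _ fun _ => abs_conjFejer_le _)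

/-- Smoothing inequality: the one-sided Laplace functional of a probability measure is controlled
by its characteristic function on `[0, 2π]`, with the sharp weight at the origin and a second term
whose weight vanishes at both ends. For lattice laws the modulus of the characteristic function has
period `2π`, so it is not small near `2π`: the vanishing of both weights there is essential. -/
theorem exists_integral_indicator_exp_le {l : ℝ} (hl : 0 < l) :
    ∃ C : ℝ, 0 ≤ C ∧ ∀ (μ : Measure ℝ) [IsProbabilityMeasure μ],
      ∫ x, (Set.Ici (0 : ℝ)).indicator (fun x => Real.exp (-l * x)) x ∂μ ≤
        (1 - Real.exp (-l))⁻¹ *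
            (∫ τ in (0 : ℝ)..1, 2 * (1 - τ) * ‖charFun μ (2 * Real.pi * τ)‖) +
          C * ∫ τ in (0 : ℝ)..1, min τ (1 - τ) * ‖charFun μ (2 * Real.pi * τ)‖ := by
  have hsum : Summable fun k : ℕ => Real.exp (-l * k) * (l * (2 * k)) := by
    have := (Real.summable_pow_mul_exp_neg_nat_mul 1 hl).mul_left (2 * l)
    refine this.congr fun k => ?_
    rw [pow_one]; ring
  refine ⟨∑' k : ℕ, Real.exp (-l * k) * (l * (2 * k)), tsum_nonneg fun k => by positivity,
    fun μ _ => ?_⟩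
  set A := ∫ τ in (0 : ℝ)..1, 2 * (1 - τ) * ‖charFun μ (2 * Real.pi * τ)‖
  set D := ∫ τ in (0 : ℝ)..1, min τ (1 - τ) * ‖charFun μ (2 * Real.pi * τ)‖
  have hint : ∀ k : ℕ, Integrable (fun x => Real.exp (-l * k) *
      (fejer (x - k) - l * (conjFejer (x - k) - conjFejer x))) μ := fun k =>
    ((integrable_fejer_sub μ k).sub (((integrable_conjFejer_sub μ k).sub
      (by simpa using integrable_conjFejer_sub μ 0)).const_mul l)).const_mul _
  have hmaj : HasSum (fun k : ℕ => ∫ x, Real.exp (-l * k) *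
      (fejer (x - k) - l * (conjFejer (x - k) - conjFejer x)) ∂μ) (∫ x, expMajorant l x ∂μ) := by
    refine hasSum_integral_of_summable_integral_norm hint ?_
    refine Summable.of_nonneg_of_le (fun k => integral_nonneg fun x => norm_nonneg _) (fun k => ?_)
      ((summable_exp_neg_mul hl).mul_right (2 + l * 2))
    have := integral_mono (hint k).norm (integrable_const (Real.exp (-l * k) * (2 + l * 2)))
      fun x => norm_expMajorant_term_le hl x k
    simpa using this
  have hle : ∫ x, (Set.Ici (0 : ℝ)).indicator (fun x => Real.exp (-l * x)) x ∂μ ≤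
      ∫ x, expMajorant l x ∂μ := by
    refine integral_mono_of_nonneg (ae_of_all _ fun x => ?_) ?_
      (ae_of_all _ (indicator_exp_le_expMajorant hl))
    · exact Set.indicator_nonneg (fun _ _ => (Real.exp_pos _).le) x
    · refine Integrable.of_bound (C := ∑' k : ℕ, Real.exp (-l * k) * (2 + l * 2))
        (continuous_expMajorant hl).aestronglyMeasurable (ae_of_all _ fun x => ?_)
      exact tsum_of_norm_bounded ((summable_exp_neg_mul hl).mul_right (2 + l * 2)).hasSum
        (norm_expMajorant_term_le hl x)
  refine hle.trans ?_
  have hbd : HasSum (fun k : ℕ => Real.exp (-l * k) * A + Real.exp (-l * k) * (l * (2 * k)) * D)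
      ((1 - Real.exp (-l))⁻¹ * A + (∑' k : ℕ, Real.exp (-l * k) * (l * (2 * k))) * D) :=
    ((hasSum_exp_neg_mul hl).mul_right A).add (hsum.hasSum.mul_right D)
  refine hasSum_le (fun k => ?_) hmaj hbd
  have hconj : Integrable (fun x => conjFejer (x - k) - conjFejer x) μ :=
    (integrable_conjFejer_sub μ k).sub (by simpa using integrable_conjFejer_sub μ 0)
  rw [integral_const_mul, integral_sub (integrable_fejer_sub μ k) (hconj.const_mul l),
    integral_const_mul]
  have h1 := integral_fejer_sub_le μ k
  have h2 := (abs_le.1 (abs_integral_conjFejer_sub_le μ k)).1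
  have h3 := mul_le_mul_of_nonneg_left h2 hl.le
  rw [mul_assoc, ← mul_add]
  refine mul_le_mul_of_nonneg_left ?_ (Real.exp_pos _).le
  linarith

/-! ### Laplace's method -/

lemma integral_id_mul_exp_neg_sq_le {b : ℝ} (hb : 0 < b) :
    ∫ τ in (0 : ℝ)..1, τ * Real.exp (-(b * τ ^ 2)) ≤ 1 / (2 * b) := by
  rw [intervalIntegral.integral_eq_sub_of_hasDerivAt
    (f := fun τ => - Real.exp (-(b * τ ^ 2)) / (2 * b)) _
    (Continuous.intervalIntegrable (by fun_prop) _ _)]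
  · have : 0 ≤ Real.exp (-(b * 1 ^ 2)) / (2 * b) := by positivity
    simp only [ne_eq, OfNat.ofNat_ne_zero, not_false_eq_true, zero_pow, mul_zero, neg_zero,
      Real.exp_zero, neg_div]
    linarith
  · intro τ _
    have h0 : HasDerivAt (fun τ : ℝ => -(b * τ ^ 2)) (-(b * (2 * τ))) τ :=
      (((hasDerivAt_pow 2 τ).const_mul b).neg).congr_deriv (by simp)
    refine (h0.exp.neg.div_const (2 * b)).congr_deriv ?_
    field_simp

lemma integral_exp_neg_sq_le {b : ℝ} (hb : 0 < b) :
    ∫ τ in (0 : ℝ)..1, Real.exp (-(b * τ ^ 2)) ≤ Real.sqrt (Real.pi / b) / 2 := by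
  rw [← integral_gaussian_Ioi, intervalIntegral.integral_of_le zero_le_one]
  simp only [neg_mul]
  refine setIntegral_mono_set ?_ (ae_of_all _ fun _ => (Real.exp_pos _).le)
    (Set.Ioc_subset_Ioi_self).eventuallyLE
  simpa only [neg_mul] using (integrable_exp_neg_mul_sq hb).integrableOn

section Laplace

variable {t : ℕ → ℝ} {A : ℕ → ℝ → ℝ} {χ R : ℝ → ℝ} {c M : ℝ}

/-- The pointwise decay of the Fourier transforms away from the two ends of `[0, 1]`. -/
lemma le_of_quadratic_decay
    (hχ0 : ∀ τ ∈ Set.Icc (0 : ℝ) (1 / 2), c * τ ^ 2 ≤ χ τ)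
    (hχ1 : ∀ τ ∈ Set.Icc (1 / 2 : ℝ) 1, c * (1 - τ) ^ 2 ≤ χ τ) (hM : 0 ≤ M) {s a τ : ℝ}
    (hs : 0 < s) (hτ : τ ∈ Set.Icc (0 : ℝ) 1) (ha : a ≤ Real.exp (-s * χ τ) * M) :
    (τ ≤ 1 / 2 → a ≤ M * Real.exp (-(s * c * τ ^ 2))) ∧
      (1 / 2 ≤ τ → a ≤ M * Real.exp (-(s * c * (1 - τ) ^ 2))) := by
  constructor
  · intro h
    refine ha.trans ?_
    rw [mul_comm]
    have := mul_le_mul_of_nonneg_left (hχ0 τ ⟨hτ.1, h⟩) hs.le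
    gcongr
    linarith
  · intro h
    refine ha.trans ?_
    rw [mul_comm]
    have := mul_le_mul_of_nonneg_left (hχ1 τ ⟨h, hτ.2⟩) hs.le
    gcongr
    linarith

lemma sqrt_mul_integral_min_mul_le (hc : 0 < c)
    (hχ0 : ∀ τ ∈ Set.Icc (0 : ℝ) (1 / 2), c * τ ^ 2 ≤ χ τ)
    (hχ1 : ∀ τ ∈ Set.Icc (1 / 2 : ℝ) 1, c * (1 - τ) ^ 2 ≤ χ τ) (hM : 0 ≤ M) {s : ℝ} (hs : 0 < s)
    {a : ℝ → ℝ} (hai : IntervalIntegrable a volume 0 1)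
    (ha : ∀ τ ∈ Set.Icc (0 : ℝ) 1, a τ ≤ Real.exp (-s * χ τ) * M) :
    Real.sqrt s * ∫ τ in (0 : ℝ)..1, min τ (1 - τ) * a τ ≤ M / (c * Real.sqrt s) := by
  have h1 : ∫ τ in (0 : ℝ)..1, min τ (1 - τ) * a τ ≤
      ∫ τ in (0 : ℝ)..1, (M * (τ * Real.exp (-(s * c * τ ^ 2))) +
        M * ((1 - τ) * Real.exp (-(s * c * (1 - τ) ^ 2)))) := by
    refine intervalIntegral.integral_mono_on zero_le_one (hai.continuousOn_mul (by fun_prop))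
      (Continuous.intervalIntegrable (by fun_prop) _ _) fun τ hτ => ?_
    obtain ⟨b1, b2⟩ := le_of_quadratic_decay hχ0 hχ1 hM hs hτ (ha τ hτ)
    have p1 : 0 ≤ M * (τ * Real.exp (-(s * c * τ ^ 2))) := by
      have := hτ.1; positivity
    have p2 : 0 ≤ M * ((1 - τ) * Real.exp (-(s * c * (1 - τ) ^ 2))) := by
      have : 0 ≤ 1 - τ := by linarith [hτ.2]
      positivity
    rcases le_total τ (1 / 2) with h | h
    · rw [min_eq_left (by linarith)]
      have := mul_le_mul_of_nonneg_left (b1 h) hτ.1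
      linarith
    · rw [min_eq_right (by linarith)]
      have := mul_le_mul_of_nonneg_left (b2 h) (by linarith [hτ.2] : 0 ≤ 1 - τ)
      linarith
  have h2 := integral_id_mul_exp_neg_sq_le (mul_pos hs hc)
  rw [intervalIntegral.integral_add (Continuous.intervalIntegrable (by fun_prop) _ _)
    (Continuous.intervalIntegrable (by fun_prop) _ _), intervalIntegral.integral_const_mul,
    intervalIntegral.integral_const_mul, intervalIntegral.integral_comp_sub_left
      (fun τ => τ * Real.exp (-(s * c * τ ^ 2))) 1, sub_self, sub_zero] at h1
  have h3 := mul_le_mul_of_nonneg_left h2 hM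
  have h4 : 0 < Real.sqrt s := Real.sqrt_pos.2 hs
  have h5 : Real.sqrt s * Real.sqrt s = s := Real.mul_self_sqrt hs.le
  calc _ ≤ Real.sqrt s * (M / (s * c)) := by
        refine mul_le_mul_of_nonneg_left (h1.trans ?_) h4.le
        have : M * (1 / (2 * (s * c))) + M * (1 / (2 * (s * c))) = M / (s * c) := by
          field_simp
          ring
        linarith
    _ = M / (c * Real.sqrt s) := by
      nth_rw 2 [← h5]
      field_simp

lemma sqrt_mul_integral_le (hc : 0 < c)
    (hχ0 : ∀ τ ∈ Set.Icc (0 : ℝ) (1 / 2), c * τ ^ 2 ≤ χ τ)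
    (hχ1 : ∀ τ ∈ Set.Icc (1 / 2 : ℝ) 1, c * (1 - τ) ^ 2 ≤ χ τ) (hM : 0 ≤ M) {s : ℝ} (hs : 0 < s)
    {a : ℝ → ℝ} (hai : IntervalIntegrable a volume 0 1)
    (ha : ∀ τ ∈ Set.Icc (0 : ℝ) 1, a τ ≤ Real.exp (-s * χ τ) * M)
    {b r K : ℝ} (hb : 0 < b) (hr : 0 < r) (hK : 0 ≤ K)
    (hχr : ∀ τ ∈ Set.Icc 0 r, b * τ ^ 2 ≤ χ τ)
    (har : ∀ τ ∈ Set.Icc 0 1, τ ≤ r → a τ ≤ Real.exp (-s * χ τ) * K) :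
    Real.sqrt s * ∫ τ in (0 : ℝ)..1, 2 * (1 - τ) * a τ ≤
      K * Real.sqrt (Real.pi / b) + 2 * M * (Real.sqrt s * Real.exp (-(s * c * r ^ 2)))
        + M / (c * Real.sqrt s) := by
  have h1 : ∫ τ in (0 : ℝ)..1, 2 * (1 - τ) * a τ ≤
      ∫ τ in (0 : ℝ)..1, (2 * K * Real.exp (-(s * b * τ ^ 2)) +
        2 * M * Real.exp (-(s * c * r ^ 2)) +
        2 * M * ((1 - τ) * Real.exp (-(s * c * (1 - τ) ^ 2)))) := by
    refine intervalIntegral.integral_mono_on zero_le_one (hai.continuousOn_mul (by fun_prop))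
      (Continuous.intervalIntegrable (by fun_prop) _ _) fun τ hτ => ?_
    obtain ⟨b1, b2⟩ := le_of_quadratic_decay hχ0 hχ1 hM hs hτ (ha τ hτ)
    have p0 : 0 ≤ 2 * (1 - τ) := by linarith [hτ.2]
    have p1 : 0 ≤ 2 * K * Real.exp (-(s * b * τ ^ 2)) := by positivity
    have p2 : 0 ≤ 2 * M * Real.exp (-(s * c * r ^ 2)) := by positivity
    have p3 : 0 ≤ 2 * M * ((1 - τ) * Real.exp (-(s * c * (1 - τ) ^ 2))) := by
      have : 0 ≤ 1 - τ := by linarith [hτ.2]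
      positivity
    rcases le_total τ r with hτr | hτr
    · have h : a τ ≤ K * Real.exp (-(s * b * τ ^ 2)) := by
        refine (har τ hτ hτr).trans ?_
        rw [mul_comm]
        have := mul_le_mul_of_nonneg_left (hχr τ ⟨hτ.1, hτr⟩) hs.le
        gcongr
        linarith
      have h' : 2 * (1 - τ) * a τ ≤ 2 * (K * Real.exp (-(s * b * τ ^ 2))) := by
        have := mul_le_mul_of_nonneg_left h p0
        have p4 : 0 ≤ K * Real.exp (-(s * b * τ ^ 2)) := by positivity
        nlinarith [hτ.1]
      linarith
    rcases le_total τ (1 / 2) with h | h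
    · have h2 : a τ ≤ M * Real.exp (-(s * c * r ^ 2)) := (b1 h).trans (by gcongr)
      have h' : 2 * (1 - τ) * a τ ≤ 2 * (M * Real.exp (-(s * c * r ^ 2))) := by
        have := mul_le_mul_of_nonneg_left h2 p0
        have p4 : 0 ≤ M * Real.exp (-(s * c * r ^ 2)) := by positivity
        nlinarith [hτ.1]
      linarith
    · have := mul_le_mul_of_nonneg_left (b2 h) p0
      linarith
  have h2 := integral_id_mul_exp_neg_sq_le (mul_pos hs hc)
  have h2' := integral_exp_neg_sq_le (mul_pos hs hb)
  rw [intervalIntegral.integral_add (Continuous.intervalIntegrable (by fun_prop) _ _)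
    (Continuous.intervalIntegrable (by fun_prop) _ _), intervalIntegral.integral_add
    (Continuous.intervalIntegrable (by fun_prop) _ _)
    (Continuous.intervalIntegrable (by fun_prop) _ _), intervalIntegral.integral_const_mul,
    intervalIntegral.integral_const_mul, intervalIntegral.integral_const_mul,
    intervalIntegral.integral_comp_sub_left
      (fun τ => τ * Real.exp (-(s * c * τ ^ 2))) 1, sub_self, sub_zero,
      intervalIntegral.integral_const, sub_zero, one_smul] at h1
  have h4 : 0 < Real.sqrt s := Real.sqrt_pos.2 hs
  have h5 : Real.sqrt s * Real.sqrt s = s := Real.mul_self_sqrt hs.le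
  have h6 : Real.sqrt (Real.pi / (s * b)) * Real.sqrt s = Real.sqrt (Real.pi / b) := by
    rw [← Real.sqrt_mul (by have := Real.pi_pos; positivity)]
    congr 1
    field_simp
  have h7 := mul_le_mul_of_nonneg_left h2 (by positivity : 0 ≤ 2 * M)
  have h8 := mul_le_mul_of_nonneg_left h2' (by positivity : 0 ≤ 2 * K)
  calc _ ≤ Real.sqrt s * (2 * K * (Real.sqrt (Real.pi / (s * b)) / 2) +
        2 * M * Real.exp (-(s * c * r ^ 2)) + 2 * M * (1 / (2 * (s * c)))) := by
        refine mul_le_mul_of_nonneg_left (h1.trans ?_) h4.le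
        linarith
    _ = K * (Real.sqrt (Real.pi / (s * b)) * Real.sqrt s) +
        2 * M * (Real.sqrt s * Real.exp (-(s * c * r ^ 2))) + Real.sqrt s * (M / (s * c)) := by
        field_simp
    _ = _ := by
      rw [h6]
      congr 1
      nth_rw 2 [← h5]
      field_simp

/-- Laplace's method: an upper bound for the two integrals in the smoothing inequality. The
integrand concentrates at `0`, where the quadratic coefficient of `χ` is at least `β`. -/
lemma eventually_laplace_le (hc : 0 < c)
    (hχ0 : ∀ τ ∈ Set.Icc (0 : ℝ) (1 / 2), c * τ ^ 2 ≤ χ τ)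
    (hχ1 : ∀ τ ∈ Set.Icc (1 / 2 : ℝ) 1, c * (1 - τ) ^ 2 ≤ χ τ)
    {β : ℝ} (hβ : 0 < β) (hχβ : ∀ b < β, ∀ᶠ τ in 𝓝[≥] (0 : ℝ), b * τ ^ 2 ≤ χ τ)
    (ht : Tendsto t atTop atTop) (hR : Continuous R) (hR0 : ∀ τ, 0 ≤ R τ)
    (hAi : ∀ n, IntervalIntegrable (A n) volume 0 1)
    (hA : ∀ ε > 0, ∀ᶠ n in atTop, ∀ τ ∈ Set.Icc (0 : ℝ) 1,
      A n τ ≤ Real.exp (-t n * χ τ) * (R τ + ε))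
    {p q : ℝ} (hp : 0 ≤ p) (hq : 0 ≤ q) {K : ℝ} (hK : p * (R 0 * Real.sqrt (Real.pi / β)) < K) :
    ∀ᶠ n in atTop, p * (Real.sqrt (t n) * ∫ τ in (0 : ℝ)..1, 2 * (1 - τ) * A n τ) +
      q * (Real.sqrt (t n) * ∫ τ in (0 : ℝ)..1, min τ (1 - τ) * A n τ) ≤ K := by
  obtain ⟨M, hM⟩ : ∃ M, ∀ τ ∈ Set.Icc (0 : ℝ) 1, R τ ≤ M := by
    obtain ⟨M, hM⟩ := (isCompact_Icc (a := (0 : ℝ)) (b := 1)).bddAbove_image hR.continuousOn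
    exact ⟨M, fun τ hτ => hM ⟨τ, hτ, rfl⟩⟩
  have hM0 : 0 ≤ M := (hR0 0).trans (hM 0 ⟨le_rfl, zero_le_one⟩)
  obtain ⟨e, he0, heβ, heK⟩ : ∃ e, 0 < e ∧ e < β ∧
      p * ((R 0 + 2 * e) * Real.sqrt (Real.pi / (β - e))) < K := by
    have hcont : ContinuousAt (fun e => p * ((R 0 + 2 * e) * Real.sqrt (Real.pi / (β - e)))) 0 := by
      have : β - 0 ≠ 0 := by simpa using hβ.ne'
      fun_prop (disch := assumption)
    have h1 := hcont.eventually_lt (g := fun _ => K) continuousAt_const (by simpa using hK)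
    have h2 : ∀ᶠ e in 𝓝[>] (0 : ℝ), e < β := nhdsWithin_le_nhds (eventually_lt_nhds hβ)
    obtain ⟨e, h3, h4, h5⟩ :=
      ((h1.filter_mono nhdsWithin_le_nhds).and (h2.and self_mem_nhdsWithin)).exists
    exact ⟨e, h5, h4, h3⟩
  obtain ⟨r, hr0, hr⟩ : ∃ r > 0, ∀ τ ∈ Set.Icc 0 r, (β - e) * τ ^ 2 ≤ χ τ ∧ R τ ≤ R 0 + e := by
    have h1 := hχβ (β - e) (by linarith)
    have h2 : ∀ᶠ τ in 𝓝[≥] (0 : ℝ), R τ < R 0 + e :=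
      ((hR.tendsto 0).eventually_lt_const (by linarith)).filter_mono nhdsWithin_le_nhds
    obtain ⟨u, hu, h3⟩ := mem_nhdsGE_iff_exists_Icc_subset.1 (h1.and h2)
    exact ⟨u, hu, fun τ hτ => ⟨(h3 hτ).1, (h3 hτ).2.le⟩⟩
  have hsqrt : Tendsto (fun n => Real.sqrt (t n)) atTop atTop :=
    Real.tendsto_sqrt_atTop.comp ht
  have l1 : Tendsto (fun n => (M + 1) / (c * Real.sqrt (t n))) atTop (𝓝 0) :=
    tendsto_const_nhds.div_atTop (hsqrt.const_mul_atTop hc)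
  have l2 : Tendsto (fun n => Real.sqrt (t n) * Real.exp (-(t n * c * r ^ 2))) atTop (𝓝 0) := by
    have h := (tendsto_rpow_mul_exp_neg_mul_atTop_nhds_zero (1 / 2) (c * r ^ 2)
      (by positivity)).comp ht
    refine h.congr fun n => ?_
    simp only [Function.comp, Real.sqrt_eq_rpow]
    ring_nf
  have hlim : Tendsto (fun n => p * ((R 0 + 2 * e) * Real.sqrt (Real.pi / (β - e)) +
      2 * (M + 1) * (Real.sqrt (t n) * Real.exp (-(t n * c * r ^ 2))) +
      (M + 1) / (c * Real.sqrt (t n))) + q * ((M + 1) / (c * Real.sqrt (t n)))) atTop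
      (𝓝 (p * ((R 0 + 2 * e) * Real.sqrt (Real.pi / (β - e)) + 2 * (M + 1) * 0 + 0) + q * 0)) :=
    (((tendsto_const_nhds.add (l2.const_mul _)).add l1).const_mul p).add (l1.const_mul q)
  have hev := hlim.eventually_lt_const (u := K) (by simpa using heK)
  filter_upwards [hev, ht.eventually_gt_atTop 0, hA e he0, hA 1 zero_lt_one] with n h1 hs h2 h3
  have ha : ∀ τ ∈ Set.Icc (0 : ℝ) 1, A n τ ≤ Real.exp (-t n * χ τ) * (M + 1) := fun τ hτ =>
    (h3 τ hτ).trans (by gcongr; exact hM τ hτ)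
  refine le_trans (add_le_add (mul_le_mul_of_nonneg_left
    (sqrt_mul_integral_le hc hχ0 hχ1 (by linarith) hs (hAi n) ha (b := β - e) (r := r)
      (K := R 0 + 2 * e) (by linarith) hr0 (by linarith [hR0 0]) (fun τ hτ => (hr τ hτ).1)
      fun τ hτ hτr => (h2 τ hτ).trans ?_) hp)
    (mul_le_mul_of_nonneg_left
      (sqrt_mul_integral_min_mul_le hc hχ0 hχ1 (by linarith) hs (hAi n) ha) hq)) h1.le
  have := (hr τ ⟨hτ.1, hτr⟩).2
  exact mul_le_mul_of_nonneg_left (by linarith) (Real.exp_pos _).le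

end Laplace

/-! ### Exponential tilting and half-line probabilities -/

section Single

variable {Ω : Type*} [MeasurableSpace Ω] {P : Measure Ω} [IsProbabilityMeasure P] {X : Ω → ℝ}

/-- Change of measure: a half-line probability is a one-sided Laplace functional under the
exponentially tilted law of `(X - u) / d`; the half-line is `[u, ∞)` or `(-∞, u]` according to the
common sign of `h` and `d`. -/
lemma measureReal_half_line_eq (hX : AEMeasurable X P) {h d : ℝ} (hd : 0 < h * d)
    (hi : Integrable (fun ω => Real.exp (h * X ω)) P) (u : ℝ) :
    P.real {ω | h * u ≤ h * X ω} = Real.exp (-(h * u)) * mgf X P h *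
      ∫ x, (Set.Ici (0 : ℝ)).indicator (fun x => Real.exp (-(h * d) * x)) x
        ∂((P.tilted (h * X ·)).map fun ω => (X ω - u) / d) := by
  have hd0 : d ≠ 0 := by rintro rfl; simp at hd
  have hm : 0 < mgf X P h := mgf_pos hi
  have hXt : AEMeasurable (fun ω => (X ω - u) / d) (P.tilted (h * X ·)) :=
    ((hX.sub_const u).div_const d).mono_ac (tilted_absolutelyContinuous _ _)
  rw [integral_map hXt
    ((Measurable.indicator (by fun_prop) measurableSet_Ici).aestronglyMeasurable),
    integral_tilted_mul_eq_mgf, ← integral_const_mul]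
  have hS : NullMeasurableSet {ω | h * u ≤ h * X ω} P :=
    nullMeasurableSet_le aemeasurable_const (hX.const_mul h)
  have hSe : P.real {ω | h * u ≤ h * X ω} =
      ∫ ω, {ω | h * u ≤ h * X ω}.indicator (1 : Ω → ℝ) ω ∂P := by
    rw [integral_indicator₀ hS]
    simp
  rw [hSe]
  congr with ω
  have hiff : ω ∈ {ω | h * u ≤ h * X ω} ↔ (X ω - u) / d ∈ Set.Ici (0 : ℝ) := by
    simp only [Set.mem_ofPred_eq, Set.mem_Ici]
    have : (X ω - u) / d = (h * (X ω - u)) / (h * d) := by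
      have : h ≠ 0 := by rintro rfl; simp at hd
      field_simp
    rw [this, le_div_iff₀ hd, zero_mul, mul_sub, sub_nonneg]
  by_cases hω : ω ∈ {ω | h * u ≤ h * X ω}
  · rw [Set.indicator_of_mem hω, Set.indicator_of_mem (hiff.1 hω)]
    have e1 : -(h * d) * ((X ω - u) / d) = h * u - h * X ω := by field_simp; ring
    rw [e1, Real.exp_sub, Real.exp_neg, smul_eq_mul, Pi.one_apply]
    have := Real.exp_pos (h * u)
    have := Real.exp_pos (h * X ω)
    field_simp
  · rw [Set.indicator_of_notMem hω, Set.indicator_of_notMem (fun h' => hω (hiff.2 h'))]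
    simp

lemma norm_charFun_tilted (hX : AEMeasurable X P) {h : ℝ}
    (hi : Integrable (fun ω => Real.exp (h * X ω)) P) (u d ξ : ℝ) :
    mgf X P h * ‖charFun ((P.tilted (h * X ·)).map fun ω => (X ω - u) / d) ξ‖ =
      ‖complexMGF X P (h + (ξ / d : ℝ) * Complex.I)‖ := by
  have hm : 0 < mgf X P h := mgf_pos hi
  have hXt : AEMeasurable (fun ω => (X ω - u) / d) (P.tilted (h * X ·)) :=
    ((hX.sub_const u).div_const d).mono_ac (tilted_absolutelyContinuous _ _)
  have e : charFun ((P.tilted (h * X ·)).map fun ω => (X ω - u) / d) ξ =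
      (mgf X P h : ℂ)⁻¹ * Complex.exp (((-(ξ * u / d) : ℝ) : ℂ) * Complex.I) *
        complexMGF X P (h + (ξ / d : ℝ) * Complex.I) := by
    rw [charFun_apply_real, integral_map hXt (Continuous.aestronglyMeasurable (by fun_prop)),
      integral_tilted_mul_eq_mgf, complexMGF, ← integral_const_mul]
    congr with ω
    rw [mul_assoc (mgf X P h : ℂ)⁻¹, ← Complex.exp_add, Complex.real_smul, Complex.ofReal_div,
      Complex.ofReal_exp, div_mul_eq_mul_div, ← Complex.exp_add, div_eq_inv_mul]
    push_cast
    congr 2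
    ring
  rw [e, norm_mul, norm_mul, norm_inv, Complex.norm_exp_ofReal_mul_I, Complex.norm_real,
    Real.norm_of_nonneg hm.le]
  field_simp

end Single

variable {Ω : ℕ → Type*} [∀ n, MeasurableSpace (Ω n)]
  {P : ∀ n, Measure (Ω n)} [∀ n, IsProbabilityMeasure (P n)]
  {X : ∀ n, Ω n → ℝ} {t : ℕ → ℝ} {η ψ : ℂ → ℂ}

/-- Sharp upper bound for half-line probabilities at the scale of large deviations, in terms of the
decay of `χ`, the (negative) logarithm of the modulus of the tilted characteristic function. -/
theorem eventually_scaled_half_line_le (hX : ∀ n, AEMeasurable (X n) (P n))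
    (hi : ∀ n s, Integrable (fun ω => Real.exp (s * X n ω)) (P n))
    (hψ : Continuous ψ) (ht : Tendsto t atTop atTop)
    (hconv : TendstoLocallyUniformly
      (fun n z => Complex.exp (-(t n : ℂ) * η z) * complexMGF (X n) (P n) z) ψ atTop)
    {h d a c β : ℝ} (hd : 0 < h * d) (hc : 0 < c) (hβ : 0 < β) {χ : ℝ → ℝ}
    (hχ : ∀ τ, χ τ = (η h - η (h + (2 * Real.pi * τ / d : ℝ) * Complex.I)).re)
    (hχ0 : ∀ τ ∈ Set.Icc (0 : ℝ) (1 / 2), c * τ ^ 2 ≤ χ τ)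
    (hχ1 : ∀ τ ∈ Set.Icc (1 / 2 : ℝ) 1, c * (1 - τ) ^ 2 ≤ χ τ)
    (hχβ : ∀ b < β, ∀ᶠ τ in 𝓝[≥] (0 : ℝ), b * τ ^ 2 ≤ χ τ)
    {K : ℝ} (hK : Real.sqrt (2 * Real.pi) * (1 - Real.exp (-(h * d)))⁻¹ *
      (‖ψ h‖ * Real.sqrt (Real.pi / β)) < K) :
    ∀ᶠ n in atTop, Real.sqrt (2 * Real.pi * t n) * Real.exp (t n * (h * a - (η h).re)) *
      (P n).real {ω | h * (t n * a) ≤ h * X n ω} ≤ K := by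
  obtain ⟨C, hC0, hC⟩ := exists_integral_indicator_exp_le hd
  set z : ℝ → ℂ := fun τ => h + (2 * Real.pi * τ / d : ℝ) * Complex.I with hz
  have hzc : Continuous z := by fun_prop
  set μ : ∀ n, Measure ℝ := fun n =>
    ((P n).tilted (h * X n ·)).map fun ω => (X n ω - t n * a) / d with hμ
  have hprob : ∀ n, IsProbabilityMeasure (μ n) := fun n => by
    have := isProbabilityMeasure_tilted (hi n h)
    exact Measure.isProbabilityMeasure_map
      ((((hX n).sub_const _).div_const d).mono_ac (tilted_absolutelyContinuous _ _))
  set A : ℕ → ℝ → ℝ := fun n τ =>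
    Real.exp (-t n * (η h).re) * mgf (X n) (P n) h * ‖charFun (μ n) (2 * Real.pi * τ)‖ with hA
  have hAi : ∀ n, IntervalIntegrable (A n) volume 0 1 := fun n =>
    (intervalIntegrable_norm_charFun_comp_mul (μ n) _ 0 1).const_mul _
  have hAeq : ∀ n τ, A n τ = Real.exp (-t n * χ τ) *
      ‖Complex.exp (-(t n : ℂ) * η (z τ)) * complexMGF (X n) (P n) (z τ)‖ := by
    intro n τ
    simp only [hA, hμ]
    rw [mul_assoc, norm_charFun_tilted (hX n) (hi n h), norm_mul, Complex.norm_exp, ← mul_assoc,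
      ← Real.exp_add, hχ]
    congr 2
    simp only [hz, Complex.mul_re, Complex.sub_re, Complex.neg_re, Complex.neg_im,
      Complex.ofReal_re, Complex.ofReal_im]
    ring
  have hAle : ∀ ε > 0, ∀ᶠ n in atTop, ∀ τ ∈ Set.Icc (0 : ℝ) 1,
      A n τ ≤ Real.exp (-t n * χ τ) * (‖ψ (z τ)‖ + ε) := by
    intro ε hε
    have hcomp : IsCompact (z '' Set.Icc 0 1) := isCompact_Icc.image hzc
    have hu := (tendstoLocallyUniformlyOn_iff_tendstoUniformlyOn_of_compact hcomp).1
      hconv.tendstoLocallyUniformlyOn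
    filter_upwards [Metric.tendstoUniformlyOn_iff.1 hu ε hε] with n hn τ hτ
    rw [hAeq]
    refine mul_le_mul_of_nonneg_left ?_ (Real.exp_pos _).le
    have h1 := hn (z τ) ⟨τ, hτ, rfl⟩
    rw [dist_comm, dist_eq_norm] at h1
    have h2 := norm_sub_norm_le
      (Complex.exp (-(t n : ℂ) * η (z τ)) * complexMGF (X n) (P n) (z τ)) (ψ (z τ))
    linarith
  have hq : 0 < 1 - Real.exp (-(h * d)) := by
    have := Real.exp_lt_one_iff.2 (by linarith : -(h * d) < 0); linarith
  have hz0 : z 0 = h := by simp [hz]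
  have hlap := eventually_laplace_le (t := t) (A := A) (χ := χ) (R := fun τ => ‖ψ (z τ)‖) hc
    hχ0 hχ1 hβ hχβ ht (by fun_prop) (fun τ => norm_nonneg _) hAi hAle
    (p := Real.sqrt (2 * Real.pi) * (1 - Real.exp (-(h * d)))⁻¹)
    (q := Real.sqrt (2 * Real.pi) * C) (by positivity) (by positivity) (K := K)
    (by simpa only [hz0] using hK)
  filter_upwards [hlap, ht.eventually_gt_atTop 0] with n hn htn
  refine le_trans ?_ hn
  rw [measureReal_half_line_eq (hX n) hd (hi n h) (t n * a)]
  have hsm := hC (μ n)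
  set I := ∫ x, (Set.Ici (0 : ℝ)).indicator (fun x => Real.exp (-(h * d) * x)) x ∂(μ n)
  set c0 := Real.exp (-t n * (η h).re) * mgf (X n) (P n) h with hc0
  have e1 : ∫ τ in (0 : ℝ)..1, 2 * (1 - τ) * A n τ =
      c0 * ∫ τ in (0 : ℝ)..1, 2 * (1 - τ) * ‖charFun (μ n) (2 * Real.pi * τ)‖ := by
    rw [← intervalIntegral.integral_const_mul]
    congr with τ
    simp only [hA]; ring
  have e2 : ∫ τ in (0 : ℝ)..1, min τ (1 - τ) * A n τ =
      c0 * ∫ τ in (0 : ℝ)..1, min τ (1 - τ) * ‖charFun (μ n) (2 * Real.pi * τ)‖ := by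
    rw [← intervalIntegral.integral_const_mul]
    congr with τ
    simp only [hA]; ring
  rw [e1, e2]
  have hc0' : 0 ≤ c0 := mul_nonneg (Real.exp_pos _).le mgf_nonneg
  have e3 : Real.exp (t n * (h * a - (η h).re)) * (Real.exp (-(h * (t n * a))) * mgf (X n) (P n) h)
      = c0 := by
    rw [← mul_assoc, ← Real.exp_add, hc0]
    ring_nf
  have e4 : Real.sqrt (2 * Real.pi * t n) = Real.sqrt (2 * Real.pi) * Real.sqrt (t n) :=
    Real.sqrt_mul (by positivity) _
  calc _ = Real.sqrt (2 * Real.pi * t n) * (Real.exp (t n * (h * a - (η h).re)) *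
        (Real.exp (-(h * (t n * a))) * mgf (X n) (P n) h)) * I := by ring
    _ = Real.sqrt (2 * Real.pi) * Real.sqrt (t n) * c0 * I := by rw [e3, e4]
    _ ≤ Real.sqrt (2 * Real.pi) * Real.sqrt (t n) * c0 * _ :=
      mul_le_mul_of_nonneg_left hsm (by positivity)
    _ = _ := by ring

/-! ### The exponent and the tilted characteristic functions -/

/-- If the characteristic function of a law has modulus `1` at `ξ ≠ 0`, the law is carried by a
shift of `(2π / ξ) ℤ`. -/
lemma carriedByLattice_of_norm_charFun {μ : Measure ℝ} [IsProbabilityMeasure μ] {ξ : ℝ}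
    (hξ : ξ ≠ 0) (h : 1 ≤ ‖charFun μ ξ‖) : CarriedByLattice μ (2 * Real.pi / |ξ|) := by
  set θ := (charFun μ ξ).arg with hθ
  have h1 : ∫ x, Real.cos (ξ * (x - θ / ξ)) ∂μ = ‖charFun μ ξ‖ := by
    rw [integral_cos_sub]
    have h3 : (ξ * (θ / ξ : ℝ) : ℂ) = θ := by
      rw [← Complex.ofReal_mul, mul_div_cancel₀ _ hξ]
    rw [h3]
    nth_rw 1 [← Complex.norm_mul_exp_arg_mul_I (charFun μ ξ)]
    rw [← hθ, mul_left_comm, ← Complex.exp_add, neg_mul, neg_add_cancel, Complex.exp_zero, mul_one,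
      Complex.ofReal_re]
  have hi : Integrable (fun x => Real.cos (ξ * (x - θ / ξ))) μ :=
    Integrable.of_bound (C := 1) (Continuous.aestronglyMeasurable (by fun_prop))
      (ae_of_all _ fun x => Real.abs_cos_le_one _)
  have h2 : ∫ x, (1 - Real.cos (ξ * (x - θ / ξ))) ∂μ = 0 := by
    have h0 : 0 ≤ ∫ x, (1 - Real.cos (ξ * (x - θ / ξ))) ∂μ :=
      integral_nonneg fun x => sub_nonneg.2 (Real.cos_le_one _)
    rw [integral_sub (integrable_const _) hi, h1] at h0 ⊢
    simp only [integral_const, probReal_univ, smul_eq_mul, mul_one] at h0 ⊢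
    linarith
  rw [integral_eq_zero_iff_of_nonneg (fun x => sub_nonneg.2 (Real.cos_le_one _))
    ((integrable_const _).sub hi)] at h2
  refine ⟨θ / ξ, ?_⟩
  rw [← mem_ae_iff]
  filter_upwards [h2] with x hx
  have hx' : Real.cos (ξ * (x - θ / ξ)) = 1 := by
    simp only [Pi.zero_apply] at hx
    linarith
  obtain ⟨k, hk⟩ := (Real.cos_eq_one_iff _).1 hx'
  rcases lt_or_gt_of_ne hξ with hneg | hpos
  · refine ⟨-k, ?_⟩
    have : x - θ / ξ = k * (2 * Real.pi) / ξ := by rw [hk]; field_simp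
    simp only [abs_of_neg hneg]
    push_cast
    have hx2 : x = θ / ξ + k * (2 * Real.pi) / ξ := by linarith
    rw [hx2]
    field_simp
  · refine ⟨k, ?_⟩
    have : x - θ / ξ = k * (2 * Real.pi) / ξ := by rw [hk]; field_simp
    simp only [abs_of_pos hpos]
    have hx2 : x = θ / ξ + k * (2 * Real.pi) / ξ := by linarith
    rw [hx2]
    field_simp

lemma norm_charFun_sub_of_carriedByLattice {μ : Measure ℝ} (hμ : CarriedByLattice μ 1) (m : ℤ)
    (ξ : ℝ) : ‖charFun μ (2 * Real.pi * m - ξ)‖ = ‖charFun μ ξ‖ := by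
  obtain ⟨γ, hγ⟩ := hμ
  rw [← mem_ae_iff] at hγ
  have : charFun μ (2 * Real.pi * m - ξ) =
      Complex.exp (((2 * Real.pi * m * γ : ℝ) : ℂ) * Complex.I) * charFun μ (-ξ) := by
    rw [charFun_apply_real, charFun_apply_real, ← integral_const_mul]
    refine integral_congr_ae ?_
    filter_upwards [hγ] with x hx
    obtain ⟨k, rfl⟩ := hx
    simp only
    rw [← Complex.exp_add, Complex.exp_eq_exp_iff_exists_int]
    refine ⟨m * k, ?_⟩
    push_cast
    ring
  rw [this, norm_mul, Complex.norm_exp_ofReal_mul_I, one_mul, charFun_neg, RCLike.norm_conj]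

lemma CarriedByLattice.mono {μ ν : Measure ℝ} (h : ν ≪ μ) {l : ℝ} (hμ : CarriedByLattice μ l) :
    CarriedByLattice ν l :=
  let ⟨γ, hγ⟩ := hμ
  ⟨γ, h hγ⟩

section Exponent

lemma mem_interior_integrableExpSet {φ : Measure ℝ}
    (hi : ∀ s : ℝ, Integrable (fun x : ℝ => Real.exp (s * x)) φ)
    (s : ℝ) : s ∈ interior (integrableExpSet id φ) := by
  have : integrableExpSet id φ = Set.univ := Set.eq_univ_of_forall hi
  rw [this, interior_univ]
  exact Set.mem_univ s

lemma hasDerivAt_realExponent {φ : Measure ℝ}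
    (hi : ∀ s : ℝ, Integrable (fun x : ℝ => Real.exp (s * x)) φ)
    (s : ℝ) : HasDerivAt (realExponent φ) (deriv (realExponent φ) s) s :=
  (analyticAt_cgf (mem_interior_integrableExpSet hi s)).differentiableAt.hasDerivAt

lemma hasDerivAt_deriv_realExponent {φ : Measure ℝ}
    (hi : ∀ s : ℝ, Integrable (fun x : ℝ => Real.exp (s * x)) φ) (s : ℝ) :
    HasDerivAt (deriv (realExponent φ)) (iteratedDeriv 2 (realExponent φ) s) s := by
  rw [iteratedDeriv_succ, iteratedDeriv_one]
  exact (analyticAt_cgf (mem_interior_integrableExpSet hi s)).deriv.differentiableAt.hasDerivAt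

variable {φ : Measure ℝ} [IsProbabilityMeasure φ] {η : ℂ → ℂ}

/-- The second derivative of the exponent is the variance of a tilted law, which is not constant. -/
lemma iteratedDeriv_two_realExponent_pos
    (hi : ∀ s : ℝ, Integrable (fun x : ℝ => Real.exp (s * x)) φ)
    (hne : ∀ a : ℝ, φ ≠ Measure.dirac a) (s : ℝ) : 0 < iteratedDeriv 2 (realExponent φ) s := by
  have hs := mem_interior_integrableExpSet hi s
  have hprob : IsProbabilityMeasure (φ.tilted (s * id ·)) := isProbabilityMeasure_tilted (hi s)
  rw [realExponent, ← variance_tilted_mul hs]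
  refine lt_of_le_of_ne (variance_nonneg _ _) fun h0 => ?_
  have h1 := ae_eq_integral_of_variance_eq_zero (memLp_tilted_mul hs 2) h0.symm
  set a := (φ.tilted (s * id ·))[id]
  have h2 : ∀ᵐ x ∂φ, x = a := (absolutelyContinuous_tilted (hi s)).ae_le h1
  refine hne a ?_
  have h3 : φ.map id = φ.map fun _ => a := Measure.map_congr h2
  rw [Measure.map_id, Measure.map_const] at h3
  simpa using h3

/-- The analytic exponent is real on the real line, where it is the cumulant generating
function. -/
lemma exponent_ofReal (hi : ∀ s : ℝ, Integrable (fun x : ℝ => Real.exp (s * x)) φ)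
    (hη : Differentiable ℂ η) (hη0 : η 0 = 0) (hexp : ∀ z, Complex.exp (η z) = complexMGF id φ z)
    (s : ℝ) : η s = (realExponent φ s : ℂ) := by
  have hd : ∀ s : ℝ, HasDerivAt (fun s : ℝ => η s - (realExponent φ s : ℂ))
      (deriv η s - (deriv (realExponent φ) s : ℝ)) s := fun s =>
    (hη s).hasDerivAt.comp_ofReal.sub (hasDerivAt_realExponent hi s).ofReal_comp
  -- the difference of two logarithms is locally constant since its exponential is `1`
  have h1 : ∀ s : ℝ, Complex.exp (η s - (realExponent φ s : ℂ)) = 1 := by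
    intro s
    rw [Complex.exp_sub, hexp, complexMGF_ofReal, ← Complex.ofReal_exp, realExponent,
      exp_cgf (X := id) (hi s)]
    have := (mgf_pos (X := id) (μ := φ) (hi s)).ne'
    exact div_self (by exact_mod_cast this)
  have h2 : ∀ s : ℝ, deriv η s - (deriv (realExponent φ) s : ℝ) = 0 := by
    intro s
    have h3 := (hd s).cexp
    simp only [h1, one_mul] at h3
    exact h3.unique (hasDerivAt_const s (1 : ℂ))
  have h4 := is_const_of_deriv_eq_zero (f := fun s : ℝ => η s - (realExponent φ s : ℂ))
    (fun s => (hd s).differentiableAt) (fun s => (hd s).deriv.trans (h2 s)) s 0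
  have h5 : realExponent φ 0 = 0 := cgf_zero
  simp only [Complex.ofReal_zero, hη0, h5, sub_zero] at h4
  exact sub_eq_zero.1 h4

lemma deriv_exponent_ofReal (hi : ∀ s : ℝ, Integrable (fun x : ℝ => Real.exp (s * x)) φ)
    (hη : Differentiable ℂ η) (hη0 : η 0 = 0) (hexp : ∀ z, Complex.exp (η z) = complexMGF id φ z)
    (s : ℝ) : deriv η s = ((deriv (realExponent φ) s : ℝ) : ℂ) := by
  have h1 := (hη s).hasDerivAt.comp_ofReal
  have h2 := (hasDerivAt_realExponent hi s).ofReal_comp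
  have h3 : (fun y : ℝ => η y) = fun y : ℝ => ((realExponent φ y : ℝ) : ℂ) :=
    funext (exponent_ofReal hi hη hη0 hexp)
  rw [h3] at h1
  exact h1.unique h2

lemma deriv_deriv_exponent_ofReal (hi : ∀ s : ℝ, Integrable (fun x : ℝ => Real.exp (s * x)) φ)
    (hη : Differentiable ℂ η) (hη0 : η 0 = 0) (hexp : ∀ z, Complex.exp (η z) = complexMGF id φ z)
    (s : ℝ) : deriv (deriv η) s = ((iteratedDeriv 2 (realExponent φ) s : ℝ) : ℂ) := by
  have h1 := (hη.deriv s).hasDerivAt.comp_ofReal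
  have h2 := (hasDerivAt_deriv_realExponent hi s).ofReal_comp
  have h3 : (fun y : ℝ => deriv η y) = fun y : ℝ => ((deriv (realExponent φ) y : ℝ) : ℂ) :=
    funext (deriv_exponent_ofReal hi hη hη0 hexp)
  rw [h3] at h1
  exact h1.unique h2

/-- Second order expansion of the exponent in the imaginary direction. -/
lemma eventually_quadratic_le (hi : ∀ s : ℝ, Integrable (fun x : ℝ => Real.exp (s * x)) φ)
    (hη : Differentiable ℂ η) (hη0 : η 0 = 0) (hexp : ∀ z, Complex.exp (η z) = complexMGF id φ z)
    (h : ℝ) {b : ℝ} (hb : b < iteratedDeriv 2 (realExponent φ) h / 2) :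
    ∀ᶠ ξ in 𝓝 (0 : ℝ), b * ξ ^ 2 ≤ (η h - η (h + (ξ : ℝ) * Complex.I)).re := by
  set κ := iteratedDeriv 2 (realExponent φ) h with hκ
  set f : ℝ → ℝ := fun ξ => (η h - η (h + (ξ : ℝ) * Complex.I)).re with hf
  have hz : ∀ ξ : ℝ, HasDerivAt (fun ξ : ℝ => (h + (ξ : ℝ) * Complex.I : ℂ)) Complex.I ξ := by
    intro ξ
    simpa using ((hasDerivAt_id ξ).ofReal_comp.mul_const Complex.I).const_add (h : ℂ)
  have hre : ∀ {g : ℝ → ℂ} {g' : ℂ} {ξ : ℝ}, HasDerivAt g g' ξ →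
      HasDerivAt (fun ξ => (g ξ).re) g'.re ξ := fun hg =>
    Complex.reCLM.hasFDerivAt.comp_hasDerivAt _ hg
  have hd1 : ∀ ξ : ℝ, HasDerivAt f (-(deriv η (h + (ξ : ℝ) * Complex.I) * Complex.I)).re ξ := by
    intro ξ
    have h1 := ((hη (h + (ξ : ℝ) * Complex.I)).hasDerivAt.comp ξ (hz ξ)).const_sub (η h)
    exact hre h1
  have hd2 : ∀ ξ : ℝ, HasDerivAt (deriv f)
      (deriv (deriv η) (h + (ξ : ℝ) * Complex.I)).re ξ := by
    intro ξ
    have h0 : deriv f = fun ξ : ℝ => (-(deriv η (h + (ξ : ℝ) * Complex.I) * Complex.I)).re :=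
      funext fun ξ => (hd1 ξ).deriv
    rw [h0]
    have h1 := (((hη.deriv (h + (ξ : ℝ) * Complex.I)).hasDerivAt.comp ξ (hz ξ)).mul_const
      Complex.I).neg
    refine (hre h1).congr_deriv ?_
    rw [mul_assoc, Complex.I_mul_I]
    simp
  have hcd : ContDiff ℝ 2 f := by
    have h1 : ContDiff ℝ 2 η := hη.contDiff.restrict_scalars ℝ
    have h2 : ContDiff ℝ 2 (fun ξ : ℝ => (h + (ξ : ℝ) * Complex.I : ℂ)) :=
      contDiff_const.add (Complex.ofRealCLM.contDiff.mul contDiff_const)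
    exact Complex.reCLM.contDiff.comp (contDiff_const.sub (h1.comp h2))
  have hT := taylor_isLittleO_univ (x₀ := 0) hcd
  have hf0 : f 0 = 0 := by simp [hf]
  have hf1 : deriv f 0 = 0 := by
    rw [(hd1 0).deriv]
    simp [deriv_exponent_ofReal hi hη hη0 hexp]
  have hf2 : iteratedDeriv 2 f 0 = κ := by
    rw [iteratedDeriv_succ, iteratedDeriv_one, (hd2 0).deriv]
    simp [deriv_deriv_exponent_ofReal hi hη hη0 hexp, hκ]
  have hpoly : ∀ ξ, taylorWithinEval f 2 Set.univ 0 ξ = κ / 2 * ξ ^ 2 := by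
    intro ξ
    rw [taylorWithinEval_succ, taylorWithinEval_succ, taylor_within_zero_eval,
      iteratedDerivWithin_univ, iteratedDerivWithin_univ]
    simp only [zero_add, iteratedDeriv_one, hf0, hf1]
    rw [hf2]
    simp
    ring
  simp only [hpoly, sub_zero] at hT
  filter_upwards [hT.bound (sub_pos.2 hb)] with ξ hξ
  rw [Real.norm_eq_abs, norm_pow, Real.norm_eq_abs, sq_abs] at hξ
  have := (abs_le.1 hξ).1
  linarith

lemma norm_charFun_tilted_eq (hi : ∀ s : ℝ, Integrable (fun x : ℝ => Real.exp (s * x)) φ)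
    (hη : Differentiable ℂ η) (hη0 : η 0 = 0) (hexp : ∀ z, Complex.exp (η z) = complexMGF id φ z)
    (h ξ : ℝ) : ‖charFun (φ.tilted (h * ·)) ξ‖ =
      Real.exp (-(η h - η (h + (ξ : ℝ) * Complex.I)).re) := by
  have h1 := norm_charFun_tilted (P := φ) (X := id) aemeasurable_id (h := h) (hi h) 0 1 ξ
  simp only [id, sub_zero, div_one, Measure.map_id'] at h1
  have h2 : mgf id φ h = Real.exp (η h).re := by
    rw [exponent_ofReal hi hη hη0 hexp, Complex.ofReal_re, realExponent, exp_cgf (X := id) (hi h)]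
  have h3 : complexMGF id φ (h + (ξ : ℝ) * Complex.I) =
    Complex.exp (η (h + (ξ : ℝ) * Complex.I)) := (hexp _).symm
  rw [h2, h3, Complex.norm_exp] at h1
  rw [Complex.sub_re, neg_sub, Real.exp_sub, eq_div_iff (Real.exp_pos _).ne', mul_comm, h1]

end Exponent

lemma exists_mul_sq_le {f : ℝ → ℝ} (hf : Continuous f) {b : ℝ} (hb : 0 < b)
    (h0 : ∀ᶠ τ in 𝓝 (0 : ℝ), b * τ ^ 2 ≤ f τ)
    (hpos : ∀ τ, 0 < τ → τ ≤ 1 / 2 → 0 < f τ) :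
    ∃ c > 0, ∀ τ ∈ Set.Icc (0 : ℝ) (1 / 2), c * τ ^ 2 ≤ f τ := by
  obtain ⟨r, hr, h1⟩ := Metric.eventually_nhds_iff_ball.1 h0
  by_cases hne : (Set.Icc (r / 2) (1 / 2 : ℝ)).Nonempty
  · obtain ⟨x, hx, hmin⟩ := isCompact_Icc.exists_isMinOn hne hf.continuousOn
    have hfx : 0 < f x := hpos x (by linarith [hx.1]) hx.2
    refine ⟨min b (f x), lt_min hb hfx, fun τ hτ => ?_⟩
    rcases lt_or_ge τ r with h | h
    · have := h1 τ (by rw [Metric.mem_ball, Real.dist_eq, sub_zero, abs_of_nonneg hτ.1]; exact h)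
      exact (mul_le_mul_of_nonneg_right (min_le_left _ _) (sq_nonneg τ)).trans this
    · have h2 : f x ≤ f τ := hmin ⟨by linarith, hτ.2⟩
      have h3 : τ ^ 2 ≤ 1 := by nlinarith [hτ.1, hτ.2]
      calc _ ≤ f x * 1 := mul_le_mul (min_le_right _ _) h3 (sq_nonneg _) hfx.le
        _ ≤ f τ := by linarith
  · refine ⟨b, hb, fun τ hτ => h1 τ ?_⟩
    rw [Set.nonempty_Icc, not_le] at hne
    rw [Metric.mem_ball, Real.dist_eq, sub_zero, abs_of_nonneg hτ.1]
    linarith [hτ.2]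

/-- Decay of the tilted characteristic function over one period: the frequency range
`[0, 2π / |d|]` is a full period for a lattice law of span `1` when `|d| = 1`, and for a non-lattice
law `d` is arbitrary. -/
lemma exists_quadratic_decay {φ : Measure ℝ} [IsProbabilityMeasure φ] {η : ℂ → ℂ}
    (hi : ∀ s : ℝ, Integrable (fun x : ℝ => Real.exp (s * x)) φ)
    (hne : ∀ a : ℝ, φ ≠ Measure.dirac a)
    (hη : Differentiable ℂ η) (hη0 : η 0 = 0) (hexp : ∀ z, Complex.exp (η z) = complexMGF id φ z)
    (h : ℝ) {d : ℝ} (hd : d ≠ 0) (hφ : (HasLatticeSpan φ 1 ∧ |d| = 1) ∨ ¬ IsLattice φ) :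
    ∃ c > 0,
      (∀ τ ∈ Set.Icc (0 : ℝ) (1 / 2),
        c * τ ^ 2 ≤ (η h - η (h + (2 * Real.pi * τ / d : ℝ) * Complex.I)).re) ∧
      ∀ τ ∈ Set.Icc (1 / 2 : ℝ) 1,
        c * (1 - τ) ^ 2 ≤ (η h - η (h + (2 * Real.pi * τ / d : ℝ) * Complex.I)).re := by
  set f : ℝ → ℝ := fun τ => (η h - η (h + (2 * Real.pi * τ / d : ℝ) * Complex.I)).re with hf
  have hηc := hη.continuous
  have hfc : Continuous f := by fun_prop
  have hprob : IsProbabilityMeasure (φ.tilted (h * ·)) := isProbabilityMeasure_tilted (hi h)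
  have hκ := iteratedDeriv_two_realExponent_pos hi hne h
  set κ := iteratedDeriv 2 (realExponent φ) h
  have hnorm : ∀ τ, ‖charFun (φ.tilted (h * ·)) (2 * Real.pi * τ / d)‖ = Real.exp (-f τ) :=
    fun τ => norm_charFun_tilted_eq hi hη hη0 hexp h _
  have hp := Real.pi_pos
  have hq : ∀ᶠ τ in 𝓝 (0 : ℝ), κ / 4 * (2 * Real.pi / d) ^ 2 * τ ^ 2 ≤ f τ := by
    have h1 := eventually_quadratic_le hi hη hη0 hexp h (b := κ / 4) (by linarith)
    have h2 : Tendsto (fun τ : ℝ => 2 * Real.pi * τ / d) (𝓝 0) (𝓝 0) := by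
      have : Continuous fun τ : ℝ => 2 * Real.pi * τ / d := by fun_prop
      simpa using this.tendsto 0
    filter_upwards [h2.eventually h1] with τ hτ
    refine le_trans (le_of_eq ?_) hτ
    ring
  have hb : 0 < κ / 4 * (2 * Real.pi / d) ^ 2 := by positivity
  -- the law cannot be carried by a lattice of span `|d| / τ`
  have hlat : ∀ τ, 0 < τ → CarriedByLattice φ (|d| / τ) ∨ 0 < f τ := by
    intro τ hτ
    by_contra! hcon
    refine hcon.1 (CarriedByLattice.mono (absolutelyContinuous_tilted (hi h)) ?_)
    have h1 := carriedByLattice_of_norm_charFun (μ := φ.tilted (h * ·))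
      (ξ := 2 * Real.pi * τ / d) (by positivity)
      (by rw [hnorm, Real.one_le_exp_iff]; linarith [hcon.2])
    convert h1 using 1
    rw [abs_div, abs_of_pos (by positivity : 0 < 2 * Real.pi * τ)]
    field_simp
  rcases hφ with ⟨hspan, hd1⟩ | hnl
  · have hpos : ∀ τ, 0 < τ → τ ≤ 1 / 2 → 0 < f τ := by
      intro τ hτ hτ2
      refine (hlat τ hτ).resolve_left fun hc => ?_
      have h1 := hspan.2 ⟨by positivity, hc⟩
      rw [hd1, div_le_one hτ] at h1
      linarith
    -- `f` is even and, since the tilted law has span `1`, of period `1`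
    have hrefl : ∀ τ, f (1 - τ) = f τ := by
      intro τ
      obtain ⟨m, hm⟩ : ∃ m : ℤ, (1 : ℝ) / d = m := by
        rcases eq_or_eq_neg_of_abs_eq hd1 with h1 | h1
        · exact ⟨1, by simp [h1]⟩
        · exact ⟨-1, by simp [h1]⟩
      have h1 := norm_charFun_sub_of_carriedByLattice
        (hspan.1.2.mono (tilted_absolutelyContinuous φ (h * ·))) m (2 * Real.pi * τ / d)
      have h2 : 2 * Real.pi * m - 2 * Real.pi * τ / d = 2 * Real.pi * (1 - τ) / d := by
        rw [← hm]; ring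
      rw [h2, hnorm, hnorm] at h1
      linarith [Real.exp_injective h1]
    obtain ⟨c, hc, h1⟩ := exists_mul_sq_le hfc hb hq hpos
    refine ⟨c, hc, h1, fun τ hτ => ?_⟩
    have := h1 (1 - τ) ⟨by linarith [hτ.2], by linarith [hτ.1]⟩
    rwa [hrefl] at this
  · have hpos : ∀ τ, 0 < τ → 0 < f τ := fun τ hτ =>
      (hlat τ hτ).resolve_left fun hc => hnl ⟨_, by positivity, hc⟩
    obtain ⟨c, hc, h1⟩ := exists_mul_sq_le hfc hb hq fun τ hτ _ => hpos τ hτ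
    obtain ⟨c', hc', h1'⟩ := exists_mul_sq_le (f := fun τ => f (1 - τ)) (by fun_prop) zero_lt_one
      (by
        have : ContinuousAt (fun τ : ℝ => 1 * τ ^ 2) 0 := by fun_prop
        have h2 : ContinuousAt (fun τ : ℝ => f (1 - τ)) 0 := by fun_prop
        refine (this.eventually_lt h2 ?_).mono fun τ hτ => hτ.le
        simpa using hpos 1 one_pos)
      fun τ hτ hτ2 => hpos _ (by linarith)
    refine ⟨min c c', lt_min hc hc', fun τ hτ => ?_, fun τ hτ => ?_⟩
    · exact (mul_le_mul_of_nonneg_right (min_le_left _ _) (sq_nonneg τ)).trans (h1 τ hτ)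
    · have := h1' (1 - τ) ⟨by linarith [hτ.2], by linarith [hτ.1]⟩
      rw [sub_sub_cancel] at this
      exact (mul_le_mul_of_nonneg_right (min_le_right _ _) (sq_nonneg _)).trans this

/-! ### The rate function and its minimizers -/

lemma rate_le {F : ℝ → EReal} {B : Set ℝ} {u : ℝ} (hu : u ∈ closure B) : rate F B ≤ F u :=
  iInf₂_le u hu

lemma mem_minimizers_of_forall_le {F : ℝ → EReal} {B : Set ℝ} {a : ℝ}
    (ha : a ∈ closure B)
    (h : ∀ u ∈ closure B, F a ≤ F u) : a ∈ minimizers F B :=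
  ⟨ha, le_antisymm (le_iInf₂ h) (rate_le ha)⟩

lemma rate_lt_top {F : ℝ → EReal} {B : Set ℝ} (hB : Admissible F B) : rate F B < ⊤ :=
  let ⟨_, hb, h⟩ := hB
  (rate_le hb).trans_lt h

section Legendre

variable {φ : Measure ℝ} [IsProbabilityMeasure φ]

lemma strictMono_deriv_realExponent
    (hi : ∀ s : ℝ, Integrable (fun x : ℝ => Real.exp (s * x)) φ)
    (hne : ∀ a : ℝ, φ ≠ Measure.dirac a) : StrictMono (deriv (realExponent φ)) :=
  strictMono_of_deriv_pos fun s => by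
    rw [(hasDerivAt_deriv_realExponent hi s).deriv]
    exact iteratedDeriv_two_realExponent_pos hi hne s

lemma realExponent_tangent_le (hi : ∀ s : ℝ, Integrable (fun x : ℝ => Real.exp (s * x)) φ)
    (hne : ∀ a : ℝ, φ ≠ Measure.dirac a) (h s : ℝ) :
    realExponent φ h + deriv (realExponent φ) h * (s - h) ≤ realExponent φ s := by
  have hm := strictMono_deriv_realExponent hi hne
  have hd := hasDerivAt_realExponent hi
  have hcont : Continuous (realExponent φ) :=
    continuous_iff_continuousAt.2 fun s => (hd s).continuousAt
  rcases lt_trichotomy h s with hs | rfl | hs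
  · obtain ⟨c, hc, he⟩ := exists_deriv_eq_slope (realExponent φ) hs hcont.continuousOn
      fun x _ => (hd x).differentiableAt.differentiableWithinAt
    have := (hm hc.1).le
    rw [he, le_div_iff₀ (by linarith)] at this
    linarith
  · simp
  · obtain ⟨c, hc, he⟩ := exists_deriv_eq_slope (realExponent φ) hs hcont.continuousOn
      fun x _ => (hd x).differentiableAt.differentiableWithinAt
    have := (hm hc.2).le
    rw [he, div_le_iff₀ (by linarith)] at this
    linarith

lemma legendre_eq_of_deriv_eq (hi : ∀ s : ℝ, Integrable (fun x : ℝ => Real.exp (s * x)) φ)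
    (hne : ∀ a : ℝ, φ ≠ Measure.dirac a) {a h : ℝ} (ha : deriv (realExponent φ) h = a) :
    legendre φ a = ((h * a - realExponent φ h : ℝ) : EReal) := by
  refine le_antisymm (iSup_le fun s => EReal.coe_le_coe_iff.2 ?_)
    (le_iSup (fun s : ℝ => ((s * a - realExponent φ s : ℝ) : EReal)) h)
  have := realExponent_tangent_le hi hne h s
  rw [ha] at this
  linarith

lemma realExponent_zero : realExponent φ 0 = 0 := cgf_zero

lemma legendre_nonneg (x : ℝ) : 0 ≤ legendre φ x := by
  have := le_iSup (fun s : ℝ => ((s * x - realExponent φ s : ℝ) : EReal)) 0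
  refine le_trans (le_of_eq ?_) this
  simp [realExponent_zero]

lemma legendre_mean (hi : ∀ s : ℝ, Integrable (fun x : ℝ => Real.exp (s * x)) φ)
    (hne : ∀ a : ℝ, φ ≠ Measure.dirac a) : legendre φ (deriv (realExponent φ) 0) = 0 := by
  rw [legendre_eq_of_deriv_eq hi hne rfl]
  simp [realExponent_zero]

lemma mul_mean_le_realExponent (hi : ∀ s : ℝ, Integrable (fun x : ℝ => Real.exp (s * x)) φ)
    (hne : ∀ a : ℝ, φ ≠ Measure.dirac a) (s : ℝ) :
    s * deriv (realExponent φ) 0 ≤ realExponent φ s := by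
  have := realExponent_tangent_le hi hne 0 s
  rw [realExponent_zero] at this
  linarith

lemma legendre_pos (hi : ∀ s : ℝ, Integrable (fun x : ℝ => Real.exp (s * x)) φ)
    {x : ℝ} (hx : x ≠ deriv (realExponent φ) 0) : 0 < legendre φ x := by
  set g : ℝ → ℝ := fun s => s * x - realExponent φ s with hg
  have hd : HasDerivAt g (x - deriv (realExponent φ) 0) 0 :=
    (((hasDerivAt_id (0 : ℝ)).mul_const x).sub (hasDerivAt_realExponent hi 0)).congr_deriv
      (by simp)
  have hnot : ¬ IsLocalMax g 0 := fun hmax => hx (sub_eq_zero.1 (hmax.hasDerivAt_eq_zero hd))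
  obtain ⟨s, hs⟩ : ∃ s, g 0 < g s := by
    by_contra! hcon
    exact hnot (Eventually.of_forall hcon)
  have h0 : g 0 = 0 := by simp [hg, realExponent_zero]
  rw [h0] at hs
  exact lt_of_lt_of_le (by exact_mod_cast hs)
    (le_iSup (fun s : ℝ => ((s * x - realExponent φ s : ℝ) : EReal)) s)

/-- The rate function increases strictly away from the mean, as long as it is finite: it is convex
and vanishes only at the mean. -/
lemma legendre_lt_of_between (hi : ∀ s : ℝ, Integrable (fun x : ℝ => Real.exp (s * x)) φ)
    (hne : ∀ a : ℝ, φ ≠ Measure.dirac a) {x y θ : ℝ} (hy : y ≠ deriv (realExponent φ) 0)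
    (hfin : legendre φ y < ⊤) (h0 : 0 ≤ θ) (h1 : θ < 1)
    (hx : x = deriv (realExponent φ) 0 + θ * (y - deriv (realExponent φ) 0)) :
    legendre φ x < legendre φ y := by
  have hpos := legendre_pos hi hy
  obtain ⟨r, hr⟩ : ∃ r : ℝ, legendre φ y = r :=
    ⟨_, (EReal.coe_toReal hfin.ne (ne_bot_of_gt hpos)).symm⟩
  rw [hr] at hpos ⊢
  have hr0 : 0 < r := by exact_mod_cast hpos
  have hle : legendre φ x ≤ ((θ * r : ℝ) : EReal) := by
    refine iSup_le fun s => EReal.coe_le_coe_iff.2 ?_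
    have e1 := mul_mean_le_realExponent hi hne s
    have e2 : s * y - realExponent φ s ≤ r := by
      have := le_iSup (fun s : ℝ => ((s * y - realExponent φ s : ℝ) : EReal)) s
      change _ ≤ legendre φ y at this
      rw [hr] at this
      exact_mod_cast this
    rw [hx]
    nlinarith
  refine hle.trans_lt ?_
  exact_mod_cast (by nlinarith : θ * r < r)

lemma legendre_lt_of_abs_lt (hi : ∀ s : ℝ, Integrable (fun x : ℝ => Real.exp (s * x)) φ)
    (hne : ∀ a : ℝ, φ ≠ Measure.dirac a) {x y σ : ℝ}
    (hx : 0 < σ * (x - deriv (realExponent φ) 0)) (hy : 0 < σ * (y - deriv (realExponent φ) 0))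
    (hxy : σ * x < σ * y) (hfin : legendre φ y < ⊤) : legendre φ x < legendre φ y := by
  set m := deriv (realExponent φ) 0
  refine legendre_lt_of_between hi hne (θ := σ * (x - m) / (σ * (y - m))) ?_ hfin (by positivity)
    ?_ ?_
  · intro h
    rw [sub_eq_zero.2 h, mul_zero] at hy
    exact lt_irrefl _ hy
  · rw [div_lt_one hy]
    linarith
  · have h1 : σ ≠ 0 := by rintro rfl; simp at hx
    have h2 : y - m ≠ 0 := by intro h; rw [h] at hy; simp at hy
    change x = m + σ * (x - m) / (σ * (y - m)) * (y - m)
    field_simp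
    ring

/-- A closed set that meets one side of a point `m` outside of it has a point closest to `m` on
that side. -/
lemma exists_closest {S : Set ℝ} (hS : IsClosed S) {m σ : ℝ} (hm : m ∉ S)
    (hne : ∃ u ∈ S, 0 < σ * (u - m)) :
    ∃ a ∈ S, 0 < σ * (a - m) ∧ ∀ u ∈ S, 0 < σ * (u - m) → σ * a ≤ σ * u := by
  obtain ⟨u0, hu0, hu0'⟩ := hne
  have hσ : σ ≠ 0 := by rintro rfl; simp at hu0'
  set T : Set ℝ := S ∩ {u | 0 ≤ σ * (u - m)} with hT
  have hTc : IsClosed T := hS.inter (isClosed_le continuous_const (by fun_prop))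
  obtain ⟨a, ha, hdist⟩ := hTc.exists_infDist_eq_dist ⟨u0, hu0, hu0'.le⟩ m
  have hpos : ∀ u ∈ T, 0 < σ * (u - m) := fun u hu => lt_of_le_of_ne hu.2 fun h => by
    rcases mul_eq_zero.1 h.symm with h | h
    · exact hσ h
    · exact hm (sub_eq_zero.1 h ▸ hu.1)
  refine ⟨a, ha.1, hpos a ha, fun u hu hu' => ?_⟩
  have h1 : dist m a ≤ dist m u := hdist ▸ Metric.infDist_le_dist_of_mem ⟨hu, hu'.le⟩
  rw [dist_comm, dist_comm m u, Real.dist_eq, Real.dist_eq] at h1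
  have h2 := mul_le_mul_of_nonneg_left h1 (abs_nonneg σ)
  rw [← abs_mul, ← abs_mul, abs_of_pos (hpos a ha), abs_of_pos hu'] at h2
  linarith

variable {B : Set ℝ}

/-- Two minimizers on the same side of the mean coincide. -/
lemma eq_of_mem_minimizers (hi : ∀ s : ℝ, Integrable (fun x : ℝ => Real.exp (s * x)) φ)
    (hne : ∀ a : ℝ, φ ≠ Measure.dirac a) (hB : Admissible (legendre φ) B) {σ x y : ℝ}
    (hx : x ∈ minimizers (legendre φ) B) (hy : y ∈ minimizers (legendre φ) B)
    (hx' : 0 < σ * (x - deriv (realExponent φ) 0))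
    (hy' : 0 < σ * (y - deriv (realExponent φ) 0)) : x = y := by
  have hσ : σ ≠ 0 := by rintro rfl; simp at hx'
  have hlt := rate_lt_top hB
  rcases lt_trichotomy (σ * x) (σ * y) with h | h | h
  · have := legendre_lt_of_abs_lt hi hne hx' hy' h (hy.2 ▸ hlt)
    rw [hx.2, hy.2] at this
    exact absurd this (lt_irrefl _)
  · exact mul_left_cancel₀ hσ h
  · have := legendre_lt_of_abs_lt hi hne hy' hx' h (hx.2 ▸ hlt)
    rw [hx.2, hy.2] at this
    exact absurd this (lt_irrefl _)

lemma exists_le_side (hi : ∀ s : ℝ, Integrable (fun x : ℝ => Real.exp (s * x)) φ)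
    (hne : ∀ a : ℝ, φ ≠ Measure.dirac a) (hm : deriv (realExponent φ) 0 ∉ closure B) (σ : ℝ)
    (hS : ∃ u ∈ closure B, 0 < σ * (u - deriv (realExponent φ) 0)) :
    ∃ a ∈ closure B, ∀ u ∈ closure B, 0 < σ * (u - deriv (realExponent φ) 0) →
      legendre φ a ≤ legendre φ u := by
  obtain ⟨a, ha, ha', hmin⟩ := exists_closest isClosed_closure hm hS
  have hσ : σ ≠ 0 := by rintro rfl; simp at ha'
  refine ⟨a, ha, fun u hu hu' => ?_⟩
  rcases (hmin u hu hu').eq_or_lt with h | h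
  · rw [mul_left_cancel₀ hσ h]
  · rcases eq_or_ne (legendre φ u) ⊤ with htop | htop
    · rw [htop]; exact le_top
    · exact (legendre_lt_of_abs_lt hi hne ha' hu' h htop.lt_top).le

lemma mean_mem_minimizers (hi : ∀ s : ℝ, Integrable (fun x : ℝ => Real.exp (s * x)) φ)
    (hne : ∀ a : ℝ, φ ≠ Measure.dirac a) (hm : deriv (realExponent φ) 0 ∈ closure B) :
    deriv (realExponent φ) 0 ∈ minimizers (legendre φ) B :=
  mem_minimizers_of_forall_le hm fun u _ => by
    rw [legendre_mean hi hne]; exact legendre_nonneg u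

lemma minimizers_nonempty (hi : ∀ s : ℝ, Integrable (fun x : ℝ => Real.exp (s * x)) φ)
    (hne : ∀ a : ℝ, φ ≠ Measure.dirac a) (hB : Admissible (legendre φ) B) :
    (minimizers (legendre φ) B).Nonempty := by
  by_cases hm : deriv (realExponent φ) 0 ∈ closure B
  · exact ⟨_, mean_mem_minimizers hi hne hm⟩
  set m := deriv (realExponent φ) 0 with hm'
  have hside : ∀ u ∈ closure B, 0 < (1 : ℝ) * (u - m) ∨ 0 < (-1 : ℝ) * (u - m) := by
    intro u hu
    rcases lt_trichotomy u m with h | rfl | h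
    · right; linarith
    · exact absurd hu hm
    · left; linarith
  by_cases h1 : ∃ u ∈ closure B, 0 < (1 : ℝ) * (u - m)
  · obtain ⟨a, ha, hamin⟩ := exists_le_side hi hne hm 1 h1
    by_cases h2 : ∃ u ∈ closure B, 0 < (-1 : ℝ) * (u - m)
    · obtain ⟨b, hb, hbmin⟩ := exists_le_side hi hne hm (-1) h2
      rcases le_total (legendre φ a) (legendre φ b) with h | h
      · exact ⟨a, mem_minimizers_of_forall_le ha fun u hu =>
          (hside u hu).elim (hamin u hu) fun h' => h.trans (hbmin u hu h')⟩
      · exact ⟨b, mem_minimizers_of_forall_le hb fun u hu =>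
          (hside u hu).elim (fun h' => h.trans (hamin u hu h')) (hbmin u hu)⟩
    · exact ⟨a, mem_minimizers_of_forall_le ha fun u hu =>
        (hside u hu).elim (hamin u hu) fun h' => absurd ⟨u, hu, h'⟩ h2⟩
  · have h2 : ∃ u ∈ closure B, 0 < (-1 : ℝ) * (u - m) := by
      obtain ⟨u, hu, _⟩ := hB
      exact ⟨u, hu, (hside u hu).resolve_left fun h' => h1 ⟨u, hu, h'⟩⟩
    obtain ⟨b, hb, hbmin⟩ := exists_le_side hi hne hm (-1) h2
    exact ⟨b, mem_minimizers_of_forall_le hb fun u hu =>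
        (hside u hu).elim (fun h' => absurd ⟨u, hu, h'⟩ h1) (hbmin u hu)⟩

lemma minimizers_eq_singleton_mean (hi : ∀ s : ℝ, Integrable (fun x : ℝ => Real.exp (s * x)) φ)
    (hne : ∀ a : ℝ, φ ≠ Measure.dirac a)
    (hm : deriv (realExponent φ) 0 ∈ minimizers (legendre φ) B) :
    minimizers (legendre φ) B = {deriv (realExponent φ) 0} := by
  refine Set.eq_singleton_iff_unique_mem.2 ⟨hm, fun x hx => ?_⟩
  by_contra hxm
  have h1 := legendre_pos hi hxm
  rw [hx.2, ← hm.2, legendre_mean hi hne] at h1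
  exact lt_irrefl _ h1

lemma encard_minimizers (hi : ∀ s : ℝ, Integrable (fun x : ℝ => Real.exp (s * x)) φ)
    (hne : ∀ a : ℝ, φ ≠ Measure.dirac a) (hB : Admissible (legendre φ) B) :
    (minimizers (legendre φ) B).encard = 1 ∨ (minimizers (legendre φ) B).encard = 2 := by
  set M := minimizers (legendre φ) B with hM
  by_cases hm : deriv (realExponent φ) 0 ∈ M
  · left
    rw [hM, minimizers_eq_singleton_mean hi hne hm, Set.encard_singleton]
  set m := deriv (realExponent φ) 0 with hm'
  have hsub : M ⊆ (M ∩ {u | 0 < (1 : ℝ) * (u - m)}) ∪ (M ∩ {u | 0 < (-1 : ℝ) * (u - m)}) := by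
    intro u hu
    rcases lt_trichotomy u m with h | rfl | h
    · exact Or.inr ⟨hu, by simp only [Set.mem_ofPred_eq]; linarith⟩
    · exact absurd hu hm
    · exact Or.inl ⟨hu, by simp only [Set.mem_ofPred_eq]; linarith⟩
  have hone : ∀ σ : ℝ, (M ∩ {u | 0 < σ * (u - m)}).encard ≤ 1 := fun σ =>
    Set.encard_le_one_iff.2 fun x y hx hy => eq_of_mem_minimizers hi hne hB hx.1 hy.1 hx.2 hy.2
  have h2 : M.encard ≤ 1 + 1 := (Set.encard_le_encard hsub).trans
    ((Set.encard_union_le _ _).trans (add_le_add (hone 1) (hone (-1))))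
  have h1 : 1 ≤ M.encard := Set.one_le_encard_iff_nonempty.2 (minimizers_nonempty hi hne hB)
  have htop : M.encard ≠ ⊤ := (h2.trans_lt (by decide)).ne
  lift M.encard to ℕ using htop with k
  norm_cast at h1 h2 ⊢
  omega

end Legendre

/-! ### Upper bounds for Borel sets -/

lemma limsup_add_le_add_limsup (u v : ℕ → ℝ≥0∞) :
    limsup (fun n => u n + v n) atTop ≤ limsup u atTop + limsup v atTop := by
  refine ENNReal.le_of_forall_pos_le_add fun ε hε htop => ?_
  obtain ⟨hu, hv⟩ := ENNReal.add_ne_top.1 htop.ne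
  have hε2 : (ε : ℝ≥0∞) / 2 ≠ 0 := by simpa using hε.ne'
  refine limsup_le_of_le (by isBoundedDefault) ?_
  filter_upwards [eventually_lt_of_limsup_lt (ENNReal.lt_add_right hu hε2),
    eventually_lt_of_limsup_lt (ENNReal.lt_add_right hv hε2)] with n h1 h2
  refine (add_le_add h1.le h2.le).trans (le_of_eq ?_)
  rw [add_add_add_comm, ENNReal.add_halves]

lemma setOf_mem_smul_subset {Ω : Type*} (X : Ω → ℝ) (t : ℝ) {B : Set ℝ} {m : ℝ}
    (hm : m ∉ closure B) :
    {ω | X ω ∈ t • B} ⊆ {ω | X ω ∈ t • (B ∩ {u | 0 < (1 : ℝ) * (u - m)})} ∪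
      {ω | X ω ∈ t • (B ∩ {u | 0 < (-1 : ℝ) * (u - m)})} := by
  rintro ω ⟨u, hu, hXu⟩
  rcases lt_trichotomy u m with h | rfl | h
  · exact Or.inr ⟨u, ⟨hu, by simp only [Set.mem_ofPred_eq]; linarith⟩, hXu⟩
  · exact absurd (subset_closure hu) hm
  · exact Or.inl ⟨u, ⟨hu, by simp only [Set.mem_ofPred_eq]; linarith⟩, hXu⟩

lemma tailTerm_zero {φ : Measure ℝ} {ψ : ℂ → ℂ} {s : ℝ} (hψ : 0 < (ψ s).re) :
    tailTerm φ ψ 0 s = ⊤ := by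
  rw [tailTerm, zero_mul, ENNReal.ofReal_zero, ENNReal.div_zero]
  exact (ENNReal.ofReal_pos.2 hψ).ne'

/-- If `x` lies on the side `σ` of the origin, and `s` has the sign of a point `y` of this side,
then `0 ≤ s * x`. -/
lemma mul_nonneg_of_same_side {σ s x y : ℝ} (hx : 0 ≤ σ * x) (hy : 0 < σ * y) (hs : 0 < s * y) :
    0 ≤ s * x := by
  have h1 : 0 ≤ (σ * x) * (σ * y) * (s * y) := by positivity
  rw [show (σ * x) * (σ * y) * (s * y) = (s * x) * (σ * y) ^ 2 by ring] at h1
  exact nonneg_of_mul_nonneg_left h1 (by positivity)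

variable {Ω : ℕ → Type*} [∀ n, MeasurableSpace (Ω n)] {P : ∀ n, Measure (Ω n)}
  {X : ∀ n, Ω n → ℝ} {t : ℕ → ℝ} {φ : Measure ℝ} [IsProbabilityMeasure φ] {η ψ : ℂ → ℂ}
  {B : Set ℝ}

namespace ModConverges

lemma exponent_eq (hc : ModConverges P X t φ η ψ) (s : ℝ) : η s = (realExponent φ s : ℂ) :=
  exponent_ofReal hc.integrable_exp_law hc.analytic_exponent hc.exponent_zero hc.exp_exponent s

lemma tendsto_real (hc : ModConverges P X t φ η ψ) (s : ℝ) :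
    Tendsto (fun n => ((Real.exp (-t n * realExponent φ s) * mgf (X n) (P n) s : ℝ) : ℂ)) atTop
      (𝓝 (ψ s)) := by
  have h := hc.tendsto_residue.tendstoLocallyUniformlyOn (s := Set.univ) |>.tendsto_at
    (Set.mem_univ (s : ℂ))
  refine h.congr fun n => ?_
  rw [hc.exponent_eq, complexMGF_ofReal]
  push_cast
  rfl

/-- On the real line the limiting function is a limit of nonnegative numbers, hence positive. -/
lemma limit_ofReal (hc : ModConverges P X t φ η ψ) (s : ℝ) :
    0 < (ψ s).re ∧ ((ψ s).re : ℂ) = ψ s := by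
  have h := hc.tendsto_real s
  have h1 : 0 ≤ (ψ s).re := ge_of_tendsto' ((Complex.continuous_re.tendsto _).comp h) fun n =>
    mul_nonneg (Real.exp_pos _).le mgf_nonneg
  have h2 : (ψ s).im = 0 :=
    tendsto_nhds_unique ((Complex.continuous_im.tendsto _).comp h)
      (tendsto_const_nhds.congr fun n => (Complex.ofReal_im _).symm)
  have h3 : ((ψ s).re : ℂ) = ψ s := Complex.ext rfl (by simp [h2])
  refine ⟨lt_of_le_of_ne h1 fun h0 => hc.limit_ne_zero s ?_, h3⟩
  rw [← h3, ← h0, Complex.ofReal_zero]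

variable [∀ n, IsProbabilityMeasure (P n)]

/-- Chernoff's bound: a half-line whose rate exceeds `r` is negligible at the scale
`exp (-t r) / √t`. -/
lemma tendsto_half_line_zero (hc : ModConverges P X t φ η ψ) {a s r : ℝ}
    (hr : r < s * a - realExponent φ s) :
    Tendsto (fun n => Real.sqrt (2 * Real.pi * t n) * Real.exp (t n * r) *
      (P n).real {ω | s * (t n * a) ≤ s * X n ω}) atTop (𝓝 0) := by
  set δ := s * a - realExponent φ s - r with hδ
  have hδ0 : 0 < δ := by linarith
  have h1 : Tendsto (fun n => Real.exp (-t n * realExponent φ s) * mgf (X n) (P n) s) atTop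
      (𝓝 (ψ s).re) := (Complex.continuous_re.tendsto _).comp (hc.tendsto_real s)
  have h2 : Tendsto (fun n => Real.sqrt (t n) * Real.exp (-(δ * t n))) atTop (𝓝 0) := by
    have h := (tendsto_rpow_mul_exp_neg_mul_atTop_nhds_zero (1 / 2) δ hδ0).comp
      hc.tendsto_parameters
    refine h.congr fun n => ?_
    simp only [Function.comp, Real.sqrt_eq_rpow]
    ring_nf
  have h3 : Tendsto (fun n => Real.sqrt (2 * Real.pi) * (Real.sqrt (t n) * Real.exp (-(δ * t n))) *
      (Real.exp (-t n * realExponent φ s) * mgf (X n) (P n) s)) atTop (𝓝 0) := by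
    simpa using (h2.const_mul (Real.sqrt (2 * Real.pi))).mul h1
  refine squeeze_zero (fun n => by positivity) (fun n => ?_) h3
  have h4 := measure_ge_le_exp_mul_mgf (μ := P n) (X := fun ω => s * X n ω) (t := 1)
    (s * (t n * a)) zero_le_one (by simpa using hc.integrable_exp n s)
  have h5 : mgf (fun ω => s * X n ω) (P n) 1 = mgf (X n) (P n) s := by simp [mgf]
  rw [h5] at h4
  have h6 : Real.exp (t n * r) * Real.exp (-1 * (s * (t n * a))) =
      Real.exp (-(δ * t n)) * Real.exp (-t n * realExponent φ s) := by
    rw [← Real.exp_add, ← Real.exp_add, hδ]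
    ring_nf
  have h7 : Real.sqrt (2 * Real.pi * t n) = Real.sqrt (2 * Real.pi) * Real.sqrt (t n) :=
    Real.sqrt_mul (by positivity) _
  calc _ ≤ Real.sqrt (2 * Real.pi * t n) * Real.exp (t n * r) *
        (Real.exp (-1 * (s * (t n * a))) * mgf (X n) (P n) s) :=
        mul_le_mul_of_nonneg_left h4 (by positivity)
    _ = Real.sqrt (2 * Real.pi * t n) * (Real.exp (t n * r) *
        Real.exp (-1 * (s * (t n * a)))) * mgf (X n) (P n) s := by ring
    _ = _ := by rw [h6, h7]; ring

/-- The sharp half-line bound, before optimising over the mesh `|d|`. -/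
lemma limsup_half_line_le (hc : ModConverges P X t φ η ψ) (hX : ∀ n, AEMeasurable (X n) (P n))
    {a h d : ℝ} (hd : 0 < h * d) (hφ : (HasLatticeSpan φ 1 ∧ |d| = 1) ∨ ¬ IsLattice φ) :
    limsup (fun n => ENNReal.ofReal (Real.sqrt (2 * Real.pi * t n) *
        Real.exp (t n * (h * a - realExponent φ h))) *
        P n {ω | h * (t n * a) ≤ h * X n ω}) atTop ≤
      ENNReal.ofReal ((ψ h).re / ((1 - Real.exp (-(h * d))) / |d| *
        Real.sqrt (iteratedDeriv 2 (realExponent φ) h))) := by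
  have hd0 : d ≠ 0 := by rintro rfl; simp at hd
  have hi := hc.integrable_exp_law
  have hκ := iteratedDeriv_two_realExponent_pos hi hc.nonconstant h
  set κ := iteratedDeriv 2 (realExponent φ) h with hκ'
  obtain ⟨c, hc0, hχ0, hχ1⟩ := exists_quadratic_decay hi hc.nonconstant hc.analytic_exponent
    hc.exponent_zero hc.exp_exponent h hd0 hφ
  have hp := Real.pi_pos
  have hq : 0 < 1 - Real.exp (-(h * d)) := by
    have := Real.exp_lt_one_iff.2 (by linarith : -(h * d) < 0); linarith
  obtain ⟨hψ0, hψ⟩ := hc.limit_ofReal h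
  set β := κ / 2 * (2 * Real.pi / d) ^ 2 with hβ
  have hβ0 : 0 < β := by positivity
  have hχβ : ∀ b < β, ∀ᶠ τ in 𝓝[≥] (0 : ℝ),
      b * τ ^ 2 ≤ (η h - η (h + (2 * Real.pi * τ / d : ℝ) * Complex.I)).re := by
    intro b hb
    have h1 := eventually_quadratic_le hi hc.analytic_exponent hc.exponent_zero hc.exp_exponent h
      (b := b / (2 * Real.pi / d) ^ 2) (by rw [div_lt_iff₀ (by positivity)]; exact hb)
    have h2 : Tendsto (fun τ : ℝ => 2 * Real.pi * τ / d) (𝓝 0) (𝓝 0) := by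
      have : Continuous fun τ : ℝ => 2 * Real.pi * τ / d := by fun_prop
      simpa using this.tendsto 0
    filter_upwards [(h2.eventually h1).filter_mono nhdsWithin_le_nhds] with τ hτ
    refine le_trans (le_of_eq ?_) hτ
    field_simp
  set K0 := (ψ h).re / ((1 - Real.exp (-(h * d))) / |d| * Real.sqrt κ) with hK0
  have hKeq : Real.sqrt (2 * Real.pi) * (1 - Real.exp (-(h * d)))⁻¹ *
      (‖ψ h‖ * Real.sqrt (Real.pi / β)) = K0 := by
    have e1 : ‖ψ h‖ = (ψ h).re := by rw [← hψ, Complex.norm_real, Real.norm_of_nonneg hψ0.le]; simp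
    have e2 : Real.sqrt (2 * Real.pi) * Real.sqrt (Real.pi / β) = |d| / Real.sqrt κ := by
      rw [← Real.sqrt_mul (by positivity), ← Real.sqrt_sq_eq_abs, ← Real.sqrt_div (sq_nonneg d), hβ]
      congr 1
      field_simp
    rw [e1, hK0]
    calc _ = (1 - Real.exp (-(h * d)))⁻¹ * (ψ h).re *
          (Real.sqrt (2 * Real.pi) * Real.sqrt (Real.pi / β)) := by ring
      _ = _ := by
        rw [e2]
        have : 0 < Real.sqrt κ := Real.sqrt_pos.2 hκ
        field_simp
  have hK0' : 0 ≤ K0 := by positivity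
  refine le_of_forall_gt_imp_ge_of_dense fun y hy => ?_
  obtain ⟨K, hK, hKy⟩ : ∃ K : ℝ, K0 < K ∧ ENNReal.ofReal K ≤ y := by
    rcases eq_or_ne y ⊤ with rfl | hy'
    · exact ⟨K0 + 1, by linarith, le_top⟩
    · exact ⟨y.toReal, (ENNReal.ofReal_lt_iff_lt_toReal hK0' hy').1 hy,
        (ENNReal.ofReal_toReal hy').le⟩
  have hev := eventually_scaled_half_line_le hX hc.integrable_exp hc.analytic_limit.continuous
    hc.tendsto_parameters hc.tendsto_residue (a := a) hd hc0 hβ0 (fun _ => rfl) hχ0 hχ1 hχβ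
    (K := K) (by rw [hKeq]; exact hK)
  refine (limsup_le_of_le (by isBoundedDefault) ?_).trans hKy
  filter_upwards [hev] with n hn
  rw [← ofReal_measureReal, ← ENNReal.ofReal_mul (by positivity)]
  rw [hc.exponent_eq, Complex.ofReal_re] at hn
  exact ENNReal.ofReal_le_ofReal hn

/-- For a lattice law of span `1` the mesh is the span. -/
lemma limsup_half_line_le_of_hasLatticeSpan (hc : ModConverges P X t φ η ψ)
    (hX : ∀ n, AEMeasurable (X n) (P n)) {a h : ℝ} (hh : h ≠ 0) (hφ : HasLatticeSpan φ 1) :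
    limsup (fun n => ENNReal.ofReal (Real.sqrt (2 * Real.pi * t n) *
        Real.exp (t n * (h * a - realExponent φ h))) *
        P n {ω | h * (t n * a) ≤ h * X n ω}) atTop ≤
      tailTerm φ ψ (1 - Real.exp (-|h|)) h := by
  have hκ := iteratedDeriv_two_realExponent_pos hc.integrable_exp_law hc.nonconstant h
  have hq : 0 < 1 - Real.exp (-|h|) := by
    have := Real.exp_lt_one_iff.2 (by simpa using hh : -|h| < 0); linarith
  have h1 : |(SignType.sign h : ℝ)| = 1 := by
    rcases lt_or_gt_of_ne hh with h0 | h0 <;> simp [h0]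
  have h2 : h * (SignType.sign h : ℝ) = |h| := by rw [mul_comm, sign_mul_self]
  have := hc.limsup_half_line_le hX (a := a) (h := h) (d := (SignType.sign h : ℝ))
    (by rw [h2]; exact abs_pos.2 hh) (Or.inl ⟨hφ, h1⟩)
  rw [h2, h1, div_one] at this
  rwa [tailTerm, ← ENNReal.ofReal_div_of_pos (by positivity)]

/-- For a non-lattice law every mesh is allowed, and the bound improves as the mesh tends to `0`. -/
lemma limsup_half_line_le_of_not_isLattice (hc : ModConverges P X t φ η ψ)
    (hX : ∀ n, AEMeasurable (X n) (P n)) {a h : ℝ} (hh : h ≠ 0) (hφ : ¬ IsLattice φ) :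
    limsup (fun n => ENNReal.ofReal (Real.sqrt (2 * Real.pi * t n) *
        Real.exp (t n * (h * a - realExponent φ h))) *
        P n {ω | h * (t n * a) ≤ h * X n ω}) atTop ≤ tailTerm φ ψ |h| h := by
  have hκ := iteratedDeriv_two_realExponent_pos hc.integrable_exp_law hc.nonconstant h
  have hh0 := abs_pos.2 hh
  have h1 : |(SignType.sign h : ℝ)| = 1 := by
    rcases lt_or_gt_of_ne hh with h0 | h0 <;> simp [h0]
  have h2 : h * (SignType.sign h : ℝ) = |h| := by rw [mul_comm, sign_mul_self]
  rw [tailTerm, ← ENNReal.ofReal_div_of_pos (by positivity)]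
  have hlim : Tendsto (fun δ : ℝ => (1 - Real.exp (-(|h| * δ))) / δ) (𝓝[>] 0) (𝓝 |h|) := by
    have hd : HasDerivAt (fun δ : ℝ => 1 - Real.exp (-(|h| * δ))) |h| 0 := by
      have h3 : HasDerivAt (fun δ : ℝ => -(|h| * δ)) (-|h|) 0 :=
        (((hasDerivAt_id (0 : ℝ)).const_mul |h|).neg).congr_deriv (by simp)
      exact (h3.exp.const_sub 1).congr_deriv (by simp)
    have h4 := hd.tendsto_slope_zero_right
    refine h4.congr fun δ => ?_
    simp [div_eq_inv_mul]
  have hlim2 := ENNReal.tendsto_ofReal ((tendsto_const_nhds (x := (ψ h).re)).div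
    (hlim.mul_const (Real.sqrt (iteratedDeriv 2 (realExponent φ) h))) (by positivity))
  refine ge_of_tendsto hlim2 ?_
  filter_upwards [self_mem_nhdsWithin] with δ hδ
  have hδ' : (0 : ℝ) < δ := hδ
  have := hc.limsup_half_line_le hX (a := a) (h := h) (d := (SignType.sign h : ℝ) * δ)
    (by rw [← mul_assoc, h2]; positivity) (Or.inr hφ)
  rwa [← mul_assoc, h2, abs_mul, h1, one_mul, abs_of_pos hδ'] at this

/-- If the rate function exceeds `r` on the part of the closed set lying on one side of the mean,
this part is negligible at the scale `exp (-t r) / √t`. -/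
lemma tendsto_side_zero (hc : ModConverges P X t φ η ψ) {r σ : ℝ} (hr : 0 ≤ r)
    (hm : deriv (realExponent φ) 0 ∉ closure B)
    (hF : ∀ u ∈ closure B, 0 < σ * (u - deriv (realExponent φ) 0) → (r : EReal) < legendre φ u) :
    Tendsto (fun n => Real.sqrt (2 * Real.pi * t n) * Real.exp (t n * r) *
      (P n).real {ω | X n ω ∈ t n • (B ∩ {u | 0 < σ * (u - deriv (realExponent φ) 0)})})
      atTop (𝓝 0) := by
  set m := deriv (realExponent φ) 0 with hm'
  by_cases hne : ∃ u ∈ closure B, 0 < σ * (u - m)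
  · obtain ⟨a, ha, ha', hmin⟩ := exists_closest isClosed_closure hm hne
    obtain ⟨s, hs⟩ := lt_iSup_iff.1 (hF a ha ha')
    have hs' : r < s * a - realExponent φ s := by exact_mod_cast hs
    have hsm : 0 < s * (a - m) := by
      have := mul_mean_le_realExponent hc.integrable_exp_law hc.nonconstant s
      rw [← hm'] at this
      linarith
    have hlim := hc.tendsto_half_line_zero hs'
    refine squeeze_zero' (Eventually.of_forall fun n => by positivity) ?_ hlim
    filter_upwards [hc.tendsto_parameters.eventually_gt_atTop 0] with n hn
    refine mul_le_mul_of_nonneg_left (measureReal_mono fun ω hω => ?_) (by positivity)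
    obtain ⟨u, ⟨huB, hu⟩, hXu⟩ := hω
    have h1 := hmin u (subset_closure huB) hu
    have h2 : 0 ≤ s * (u - a) :=
      mul_nonneg_of_same_side (by linarith : 0 ≤ σ * (u - a)) ha' hsm
    simp only [Set.mem_ofPred_eq, ← hXu, smul_eq_mul]
    nlinarith
  · have hempty : ∀ n, {ω | X n ω ∈ t n • (B ∩ {u | 0 < σ * (u - m)})} = ∅ := by
      intro n
      refine Set.eq_empty_of_forall_notMem fun ω hω => ?_
      obtain ⟨u, ⟨huB, hu⟩, -⟩ := hω
      exact hne ⟨u, subset_closure huB, hu⟩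
    simp only [hempty, measureReal_empty, mul_zero]
    exact tendsto_const_nhds

/-- The contribution of one side of the mean to the limit superior, where `T h` bounds the scaled
half-line probabilities attached to the parameter `h`. -/
lemma exists_limsup_side_le (hc : ModConverges P X t φ η ψ) {r σ : ℝ} (hσ : σ ≠ 0)
    (hB : rate (legendre φ) B = r)
    (hm : deriv (realExponent φ) 0 ∉ closure B) {T : ℝ → ℝ≥0∞}
    (hT : ∀ a h : ℝ, h ≠ 0 → limsup (fun n => ENNReal.ofReal (Real.sqrt (2 * Real.pi * t n) *
        Real.exp (t n * (h * a - realExponent φ h))) *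
        P n {ω | h * (t n * a) ≤ h * X n ω}) atTop ≤ T h)
    {h : ℝ → ℝ} (hh : ∀ a ∈ minimizers (legendre φ) B, deriv (realExponent φ) (h a) = a) :
    ∃ a, 0 < σ * (a - deriv (realExponent φ) 0) ∧
      limsup (fun n => ENNReal.ofReal (Real.sqrt (2 * Real.pi * t n) * Real.exp (t n * r)) *
        P n {ω | X n ω ∈ t n • (B ∩ {u | 0 < σ * (u - deriv (realExponent φ) 0)})}) atTop ≤
      (minimizers (legendre φ) B).indicator (fun a => T (h a)) a := by
  have hi := hc.integrable_exp_law
  have hne := hc.nonconstant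
  set m := deriv (realExponent φ) 0 with hm'
  by_cases hex : ∃ a ∈ minimizers (legendre φ) B, 0 < σ * (a - m)
  · obtain ⟨a, ha, ha'⟩ := hex
    refine ⟨a, ha', ?_⟩
    rw [Set.indicator_of_mem ha]
    have hF := legendre_eq_of_deriv_eq hi hne (hh a ha)
    have hr : r = h a * a - realExponent φ (h a) := by
      rw [ha.2, hB] at hF
      exact_mod_cast hF
    have hmono := strictMono_deriv_realExponent hi hne
    have ham : a ≠ m := by rintro rfl; simp at ha'
    have hh0 : h a ≠ 0 := fun h0 => ham (by rw [← hh a ha, h0])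
    have hpos : 0 < h a * (a - m) := by
      rcases lt_or_gt_of_ne hh0 with h0 | h0
      · have := hmono h0
        rw [hh a ha] at this
        exact mul_pos_of_neg_of_neg h0 (by linarith)
      · have := hmono h0
        rw [hh a ha] at this
        exact mul_pos h0 (by linarith)
    refine le_trans (limsup_le_limsup ?_) (hT a (h a) hh0)
    filter_upwards [hc.tendsto_parameters.eventually_gt_atTop 0] with n hn
    rw [← hr]
    refine mul_le_mul_right (measure_mono fun ω hω => ?_) _
    obtain ⟨u, ⟨huB, hu⟩, hXu⟩ := hω
    have h1 : σ * a ≤ σ * u := by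
      by_contra! hlt
      have h2 := legendre_lt_of_abs_lt hi hne hu ha' hlt
        (by rw [ha.2, hB]; exact EReal.coe_lt_top r)
      rw [ha.2] at h2
      exact absurd (rate_le (subset_closure huB)) (not_le.2 h2)
    have h2 : 0 ≤ h a * (u - a) :=
      mul_nonneg_of_same_side (by linarith : 0 ≤ σ * (u - a)) ha' hpos
    simp only [Set.mem_ofPred_eq, ← hXu, smul_eq_mul]
    nlinarith
  -- no minimizer on this side: any point of the side serves, its term being at least `0`
  · refine ⟨m + σ, by rw [add_sub_cancel_left]; exact mul_self_pos.2 hσ, ?_⟩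
    have hr0 : 0 ≤ r := by
      have : (0 : EReal) ≤ rate (legendre φ) B := le_iInf₂ fun u _ => legendre_nonneg u
      rw [hB] at this
      exact_mod_cast this
    have hlim := hc.tendsto_side_zero (B := B) (r := r) (σ := σ) hr0 hm fun u hu hu' =>
      lt_of_le_of_ne (hB ▸ rate_le hu) fun heq => hex ⟨u, ⟨hu, by rw [hB, heq]⟩, hu'⟩
    have hlim2 := ENNReal.tendsto_ofReal hlim
    rw [ENNReal.ofReal_zero] at hlim2
    refine le_trans (le_of_eq ?_) zero_le
    rw [← hlim2.limsup_eq]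
    congr 1 with n
    rw [ENNReal.ofReal_mul
      (by positivity : 0 ≤ Real.sqrt (2 * Real.pi * t n) * Real.exp (t n * r)), ofReal_measureReal]

/-- The upper bound for admissible sets, from any bound `T` on half-line probabilities which is
infinite at `0`. -/
lemma limsup_scaledProb_le (hc : ModConverges P X t φ η ψ) (hB : Admissible (legendre φ) B)
    {T : ℝ → ℝ≥0∞} (hT0 : T 0 = ⊤)
    (hT : ∀ a h : ℝ, h ≠ 0 → limsup (fun n => ENNReal.ofReal (Real.sqrt (2 * Real.pi * t n) *
        Real.exp (t n * (h * a - realExponent φ h))) *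
        P n {ω | h * (t n * a) ≤ h * X n ω}) atTop ≤ T h)
    {h : ℝ → ℝ} (hh : ∀ a ∈ minimizers (legendre φ) B, deriv (realExponent φ) (h a) = a) :
    limsup (scaledProb P X t φ B) atTop ≤ ∑' a : minimizers (legendre φ) B, T (h a) := by
  have hi := hc.integrable_exp_law
  have hne := hc.nonconstant
  by_cases hm : deriv (realExponent φ) 0 ∈ closure B
  · have hmem := mean_mem_minimizers hi hne hm
    have h0 : h (deriv (realExponent φ) 0) = 0 :=
      (strictMono_deriv_realExponent hi hne).injective (hh _ hmem)
    refine le_top.trans (le_of_eq ?_)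
    refine (ENNReal.tsum_eq_top_of_eq_top ⟨⟨_, hmem⟩, ?_⟩).symm
    rw [h0, hT0]
  set m := deriv (realExponent φ) 0 with hm'
  obtain ⟨r, hr⟩ : ∃ r : ℝ, rate (legendre φ) B = r := by
    refine ⟨_, (EReal.coe_toReal (rate_lt_top hB).ne ?_).symm⟩
    have : (0 : EReal) ≤ rate (legendre φ) B := le_iInf₂ fun u _ => legendre_nonneg u
    exact ne_bot_of_le_ne_bot (by simp) this
  obtain ⟨a, ha, hla⟩ := hc.exists_limsup_side_le (σ := 1) one_ne_zero hr hm hT hh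
  obtain ⟨b, hb, hlb⟩ := hc.exists_limsup_side_le (σ := -1) (by norm_num) hr hm hT hh
  have hab : a ≠ b := by rintro rfl; linarith
  set u : ℕ → ℝ≥0∞ := fun n => ENNReal.ofReal (Real.sqrt (2 * Real.pi * t n) *
    Real.exp (t n * r)) * P n {ω | X n ω ∈ t n • (B ∩ {u | 0 < (1 : ℝ) * (u - m)})}
  set v : ℕ → ℝ≥0∞ := fun n => ENNReal.ofReal (Real.sqrt (2 * Real.pi * t n) *
    Real.exp (t n * r)) * P n {ω | X n ω ∈ t n • (B ∩ {u | 0 < (-1 : ℝ) * (u - m)})}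
  have hle : limsup (scaledProb P X t φ B) atTop ≤ limsup (fun n => u n + v n) atTop := by
    refine limsup_le_limsup (Eventually.of_forall fun n => ?_)
    simp only [scaledProb, hr, EReal.toReal_coe, u, v]
    rw [← mul_add]
    exact mul_le_mul_right ((measure_mono (setOf_mem_smul_subset (X n) (t n) hm)).trans
      (measure_union_le _ _)) _
  refine (hle.trans (limsup_add_le_add_limsup u v)).trans ((add_le_add hla hlb).trans ?_)
  rw [tsum_subtype (minimizers (legendre φ) B) fun a => T (h a), ← Finset.sum_pair hab
    (f := (minimizers (legendre φ) B).indicator fun a => T (h a))]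
  exact ENNReal.sum_le_tsum _

lemma tendsto_of_not_admissible (hc : ModConverges P X t φ η ψ)
    (hB : ¬ Admissible (legendre φ) B) {M : ℝ} (hM : 0 < M) :
    Tendsto (fun n => Real.exp (t n * M) * (P n).real {ω | X n ω ∈ t n • B}) atTop (𝓝 0) := by
  have htop : ∀ u ∈ closure B, legendre φ u = ⊤ := fun u hu => by
    by_contra h
    exact hB ⟨u, hu, lt_top_iff_ne_top.2 h⟩
  have hm : deriv (realExponent φ) 0 ∉ closure B := fun hm => by
    have h1 := legendre_mean hc.integrable_exp_law hc.nonconstant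
    rw [htop _ hm] at h1
    exact absurd h1 (by simp)
  have hside : ∀ σ : ℝ, _ := fun σ => hc.tendsto_side_zero (B := B) (r := M) (σ := σ) hM.le hm
    fun u hu _ => by rw [htop u hu]; exact EReal.coe_lt_top M
  have hlim := (hside 1).add (hside (-1))
  rw [add_zero] at hlim
  refine squeeze_zero' (Eventually.of_forall fun n => by positivity) ?_ hlim
  filter_upwards [hc.tendsto_parameters.eventually_ge_atTop 1] with n hn
  rw [← mul_add]
  have h1 : (1 : ℝ) ≤ Real.sqrt (2 * Real.pi * t n) := by
    rw [Real.one_le_sqrt]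
    nlinarith [Real.pi_gt_three]
  have h2 : (P n).real {ω | X n ω ∈ t n • B} ≤ _ :=
    (measureReal_mono (setOf_mem_smul_subset (X n) (t n) hm)).trans (measureReal_union_le _ _)
  refine mul_le_mul (le_mul_of_one_le_left (Real.exp_pos _).le h1) h2 measureReal_nonneg
    (by positivity)

end ModConverges

end ModPhi

theorem theorem6p2 {Ω : ℕ → Type*} [∀ n, MeasurableSpace (Ω n)]
    (P : ∀ n, Measure (Ω n)) [∀ n, IsProbabilityMeasure (P n)]
    (X : ∀ n, Ω n → ℝ) (hX : ∀ n, AEMeasurable (X n) (P n))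
    (t : ℕ → ℝ) (φ : Measure ℝ) [IsProbabilityMeasure φ] (η ψ : ℂ → ℂ)
    (hconv : ModPhi.ModConverges P X t φ η ψ)
    (hF : ModPhi.EssentiallySmooth (ModPhi.legendre φ))
    (B : Set ℝ) (hB : MeasurableSet B) :
    (ModPhi.Admissible (ModPhi.legendre φ) B →
      ((ModPhi.minimizers (ModPhi.legendre φ) B).encard = 1 ∨
        (ModPhi.minimizers (ModPhi.legendre φ) B).encard = 2) ∧
      ∀ h : ℝ → ℝ,
        (∀ a ∈ ModPhi.minimizers (ModPhi.legendre φ) B,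
          deriv (ModPhi.realExponent φ) (h a) = a) →
        (ModPhi.HasLatticeSpan φ 1 →
          limsup (ModPhi.scaledProb P X t φ B) atTop ≤
            ∑' a : ModPhi.minimizers (ModPhi.legendre φ) B,
              ModPhi.tailTerm φ ψ (1 - Real.exp (-|h a|)) (h a)) ∧
        (¬ ModPhi.IsLattice φ →
          limsup (ModPhi.scaledProb P X t φ B) atTop ≤
            ∑' a : ModPhi.minimizers (ModPhi.legendre φ) B,
              ModPhi.tailTerm φ ψ |h a| (h a))) ∧
    (¬ ModPhi.Admissible (ModPhi.legendre φ) B →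
      ∀ M : ℝ, 0 < M →
        Tendsto (fun n => Real.exp (t n * M) * (P n).real {ω | X n ω ∈ t n • B}) atTop (𝓝 0)) := by
  have hψ0 : 0 < (ψ ((0 : ℝ) : ℂ)).re := (hconv.limit_ofReal 0).1
  refine ⟨fun hadm => ⟨ModPhi.encard_minimizers hconv.integrable_exp_law hconv.nonconstant hadm,
    fun h hh => ⟨fun hlat => ?_, fun hlat => ?_⟩⟩,
    fun hadm M hM => hconv.tendsto_of_not_admissible hadm hM⟩
  · exact hconv.limsup_scaledProb_le hadm
      (T := fun s => ModPhi.tailTerm φ ψ (1 - Real.exp (-|s|)) s)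
      (by simpa using ModPhi.tailTerm_zero hψ0)
      (fun a s hs => hconv.limsup_half_line_le_of_hasLatticeSpan hX hs hlat) hh
  · exact hconv.limsup_scaledProb_le hadm (T := fun s => ModPhi.tailTerm φ ψ |s| s)
      (by simpa using ModPhi.tailTerm_zero hψ0)
      (fun a s hs => hconv.limsup_half_line_le_of_not_isLattice hX hs hlat) hh
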